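/- **Setting.** Let $n\ge 1$, and let $c_1,c_2,\dots:\mathbb R^n\to\mathbb R$ be convex differentiable functions for which there are constants $K>0$ and $l,L,m$ such that, for all $t\ge1$ and all $y,z\in\mathbb R^n$ (Euclidean norm), $\|\nabla c_t(y)\|\le l$, $\|\nabla c_t(y)-\nabla c_t(z)\|\le L\|y-z\|$, $(y,\nabla c_t(y))>0$ whenever $\|y\|^2>K$, and $|c_t(0)|\le m$. Let $a,b$ be *admissible*: $0<a<1$, $b>0$, $2a-2b>1$. Put $\alpha_t=(nt)^{-a}$, $\sigma_t=(nt)^{-b}$, fix $\mu_1\in\mathbb R^n$, and for $t=1,2,\dots$ let $x_t$, given $\mu_1,\dots,\mu_t$, be normally distributed with independent coordinates of means $\mu_t^i$ and standard deviation $\sigma_t$, and $$\mu_{t+1}=\mu_t-\alpha_t\,c_t(x_t)\,\frac{x_t-\mu_t}{\sigma_t^2}.$$ For $y\in\mathbb R^n$ let $R_y(T)=\sum_{t=1}^T c_t(x_t)-\sum_{t=1}^T c_t(y)$. **Theorem.** 1. $\mathrm E\|\mu_t\|^2<\infty$ for all $t\ge1$, and $R_y(T)$ is integrable for all $y$ and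 $T$. 2. For all admissible $a,b$ there is $C>0$, depending only on $a,b$, such that for all $n$, all cost sequences as above, every run of the algorithm, all $T\ge1$, every $M$ with $\mathrm E\|\mu_t\|^2\le M^2$ for $1\le t\le T$, and every $y$, $$\mathrm E\Big[\frac{R_y(T)}T\Big]\le (M^2+\|y\|^2)\,C\frac{n^a}{T^{1-a}}+\Big(m^2+l^2\Big(M^2+\frac{n^{1-2b}}{T^{2b}}\Big)\Big)C\frac{n^{1-a+2b}}{T^{a-2b}}+L\,C\frac{n^{1-2b}}{T^{2b}} .$$ 3. For all admissible $a,b$ with $a+2b\ne1$ there is $C>0$, depending only on $a,b$, such that for all $n,K,l,L,m,\mu_1$ there is a constant $M$, depending only on $a,b,n,K,l,L,m,\mu_1$ (not on $T$, $y$ or the cost sequence), such that for every such cost sequence, all $T\ge1$ and all $y$, $$\mathrm E\Big[\frac{R_y(T)}T\Big]\le (M^2+\|y\|^2)\,C\frac{n^a}{T^{1-a}}+l^2\,C\frac{n^{1-a+2b}}{T^{a-2b}}+L\,C\frac{n^{1-2b}}{T^{2b}} ;$$ if moreover $a+2b>1$, then the same $M$ satisfies $\mathrm E\|\mu_t\|^2\le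 M^2$ for all $t\ge1$. 4. For all admissible $a,b$ and all $y$, $\ \limsup_{T\to\infty}\mathrm E[R_y(T)/T]\le0$. 5. The point $(2/3,1/6)$ is a limit of admissible pairs $(a,b)$, and it is optimal: for every admissible pair $\min(1-a,\,a-2b,\,2b)<\tfrac13$ and $\max(a,\,1-a+2b,\,1-2b)>\tfrac23$. As $a\to\frac23$, $b\to\frac16$ the average regret has rate $n^{2/3}/T^{1/3}$ (regret $n^{2/3}T^{2/3}$) in the following sense. For every $\varepsilon>0$ there are $\delta,C>0$, depending only on $\varepsilon$, such that for all admissible $a,b$ with $|a-\frac23|<\delta$, $|b-\frac16|<\delta$ and all $n,K,l,L,m,\mu_1$ there is a constant $M$, depending only on $a,b,n,K,l,L,m,\mu_1$, such that for every such cost sequence, all $T\ge1$ and all $y$, $$\mathrm E\Big[\frac{R_y(T)}T\Big]\le (M^2+\|y\|^2+L+l^2)\,C\,\frac{n^{2/3+\varepsilon}}{T^{1/3-\varepsilon}},$$ and, for every $M'$ with $\mathrm E\|\mu_t\|^2\le M'^2$ for $1\le t\le T$, $$\mathrm E\Big[\frac{R_y(T)}T\Big]\le \Big(M'^2+\|y\|^2+L+m^2+l^2\Big(M'^2+\frac{n^{1-2b}}{T^{2b}}\Big)\Big)C\,\frac{n^{2/3+\varepsilon}}{T^{1/3-\varepsilon}}.$$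 -/

import Mathlib

open MeasureTheory ProbabilityTheory Filter

universe u

/-- The parameter range `0 < a < 1`, `b > 0`, `2a - 2b > 1`. -/
structure AdmissibleExponents (a b : ℝ) : Prop where
  a_pos : 0 < a
  a_lt_one : a < 1
  b_pos : 0 < b
  gap : 1 < 2 * a - 2 * b

/-- Step size `α_t = (n t)^{-a}`. -/
noncomputable def stepSize (a : ℝ) (n t : ℕ) : ℝ := 1 / ((n : ℝ) * (t : ℝ)) ^ a

/-- Standard deviation `σ_t = (n t)^{-b}` of each coordinate of the query point. -/
noncomputable def querySd (b : ℝ) (n t : ℕ) : ℝ := 1 / ((n : ℝ) * (t : ℝ)) ^ b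

/-- The class of cost sequences `c 1, c 2, …` on `ℝⁿ` (the value `c 0` is not used). -/
structure CostClass (n : ℕ) (K l L m : ℝ) (c : ℕ → EuclideanSpace ℝ (Fin n) → ℝ) : Prop where
  convex : ∀ t, 1 ≤ t → ConvexOn ℝ Set.univ (c t)
  differentiable : ∀ t, 1 ≤ t → Differentiable ℝ (c t)
  gradient_bound : ∀ t, 1 ≤ t → ∀ y, ‖gradient (c t) y‖ ≤ l
  gradient_lipschitz : ∀ t, 1 ≤ t → ∀ y z,
    ‖gradient (c t) y - gradient (c t) z‖ ≤ L * ‖y - z‖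
  inner_pos : ∀ t, 1 ≤ t → ∀ y, K < ‖y‖ ^ 2 → 0 < inner ℝ y (gradient (c t) y)
  value_bound : ∀ t, 1 ≤ t → |c t 0| ≤ m

/-- The Markov kernel `μ ↦ N(μ, σ)`: the law of `μ + σ Z` with `Z` standard Gaussian on `ℝⁿ`,
that is, independent coordinates with means `μⁱ` and standard deviation `σ`. -/
noncomputable def queryKernel (n : ℕ) (σ : ℝ) :
    Kernel (EuclideanSpace ℝ (Fin n)) (EuclideanSpace ℝ (Fin n)) :=
  (Kernel.id ×ₖ Kernel.const _ (stdGaussian (EuclideanSpace ℝ (Fin n)))).map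
    (fun p => p.1 + σ • p.2)

/-- `(μ_t, x_t)`, `t ≥ 1`, is a run of the one-point algorithm on the costs `c` started at the
deterministic mean `μ₁`: given `μ_1, …, μ_t` the query point `x_t` has law `N(μ_t, σ_t)`, and
`μ_{t+1} = μ_t - α_t c_t(x_t) (x_t - μ_t) / σ_t²`. -/
structure OnePointRun {n : ℕ} (a b : ℝ) (c : ℕ → EuclideanSpace ℝ (Fin n) → ℝ)
    (μ₁ : EuclideanSpace ℝ (Fin n)) {Ω : Type u} [MeasurableSpace Ω] (P : Measure Ω)
    (μ x : ℕ → Ω → EuclideanSpace ℝ (Fin n)) : Prop where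
  init : ∀ᵐ ω ∂P, μ 1 ω = μ₁
  query : ∀ t (ht : 1 ≤ t),
    HasCondDistrib (x t) (fun ω (k : Finset.Icc 1 t) => μ k ω)
      ((queryKernel n (querySd b n t)).comap
        (fun h : Finset.Icc 1 t → EuclideanSpace ℝ (Fin n) =>
          h ⟨t, Finset.mem_Icc.2 ⟨ht, le_refl t⟩⟩)
        (measurable_pi_apply _)) P
  update : ∀ t, 1 ≤ t → ∀ᵐ ω ∂P,
    μ (t + 1) ω = μ t ω -
      (stepSize a n t * c t (x t ω) / querySd b n t ^ 2) • (x t ω - μ t ω)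

/-- The regret `R_y(T) = ∑_{t=1}^T c_t(x_t) - ∑_{t=1}^T c_t(y)` against the comparator `y`. -/
noncomputable def regret {n : ℕ} (c : ℕ → EuclideanSpace ℝ (Fin n) → ℝ) {Ω : Type u}
    (x : ℕ → Ω → EuclideanSpace ℝ (Fin n)) (y : EuclideanSpace ℝ (Fin n)) (T : ℕ) (ω : Ω) : ℝ :=
  ∑ t ∈ Finset.Icc 1 T, c t (x t ω) - ∑ t ∈ Finset.Icc 1 T, c t y

/-- The expected average regret `E[R_y(T) / T]`. -/
noncomputable def expAvgRegret {n : ℕ} (c : ℕ → EuclideanSpace ℝ (Fin n) → ℝ) {Ω : Type u}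
    [MeasurableSpace Ω] (P : Measure Ω) (x : ℕ → Ω → EuclideanSpace ℝ (Fin n))
    (y : EuclideanSpace ℝ (Fin n)) (T : ℕ) : ℝ :=
  ∫ ω, regret c x y T ω / (T : ℝ) ∂P

/-! The update uses a single cost value, yet on average it is a gradient step. For a standard
Gaussian Z, integration by parts gives E[f(u+σZ)⟨Z,w⟩] = σ E⟨∇f(u+σZ),w⟩
(`RegularCost.integral_comp_mul_inner`). With w = u - y, convexity between the shifted points u+σZ
and y+σZ bounds this below by σ(E f(u+σZ) - E f(y+σZ)); since Z is centred, the Lipschitz gradient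
costs only E f(y+σZ) ≤ f(y) + Lσ²n. Expanding D_{t+1} = E‖μ_{t+1}-y‖² then bounds the expected
regret of round t by (D_t - D_{t+1})/(2α_t), a bias Lnσ_t², and a variance term of order α_t/σ_t².
Summation by parts against the increasing weights 1/α_t yields the three terms of the rate, for any
bound on E‖μ_t‖² (`OnePointRun.expAvgRegret_le`).

It remains to bound E‖μ_t‖². Beyond radius 2√K the smoothed gradient points outwards, up to Lσ²n and
a Gaussian tail of arbitrarily high order in σ. So the mean square e_t of the part of μ_t outside
that ball obeys e_{t+1} ≤ (1+ε_t)e_t + δ_t + g_t, where ε_t and δ_t are multiples of t^{-(2a-2b)},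
summable because 2a-2b > 1, and g_t = 2Lnα_tσ_t². A discrete Grönwall argument started late enough
gives E‖μ_t‖² ≤ D + 8Ln ∑_{s≤t} α_sσ_s², with an absolute factor on the sum
(`exists_secondMoment_bound`). This factor matters when a+2b < 1: multiplied by n^a/T^{1-a}, the
growing sum has exactly the order n^{1-2b}/T^{2b} of the bias term, so C need not depend on the
data.

Finally n^{1-a+2b}/T^{a-2b} is at most T^{-(2a-2b-1)} times n^a/T^{1-a}. For large T this gain beats
l², and small T go into the constant (`exists_uniform_bound`). The various rates differ only in how
the bias sum is estimated. -/

open scoped NNReal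

variable {n : ℕ}

/-! ### Gaussian moments and integration by parts -/

/-- Gaussian integration by parts on the line. -/
theorem integral_id_mul_gaussianReal {g g' : ℝ → ℝ} (hg : ∀ s, HasDerivAt g (g' s) s)
    (h0 : Integrable g (gaussianReal 0 1)) (h1 : Integrable (fun s => s * g s) (gaussianReal 0 1))
    (h2 : Integrable g' (gaussianReal 0 1)) :
    ∫ s, s * g s ∂(gaussianReal 0 1) = ∫ s, g' s ∂(gaussianReal 0 1) := by
  -- The density φ solves φ' = -sφ, so the factor s is a derivative falling on φ.
  have hpdf : ∀ s, HasDerivAt (gaussianPDFReal 0 1) (-s * gaussianPDFReal 0 1 s) s := by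
    intro s
    have h : HasDerivAt (fun x : ℝ => -(x - 0) ^ 2 / (2 * ((1 : ℝ≥0) : ℝ))) (-s) s := by
      have h1 := (((hasDerivAt_id s).sub_const 0).pow 2).neg.div_const (2 * ((1 : ℝ≥0) : ℝ))
      refine h1.congr_deriv ?_
      simp
      ring
    rw [gaussianPDFReal_def]
    refine (h.exp.const_mul _).congr_deriv ?_
    ring
  have hint : ∀ {f : ℝ → ℝ}, Integrable f (gaussianReal 0 1) →
      Integrable (fun s => gaussianPDFReal 0 1 s * f s) := by
    intro f hf
    rw [gaussianReal_of_var_ne_zero 0 one_ne_zero] at hf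
    have := (integrable_withDensity_iff_integrable_smul' (measurable_gaussianPDF 0 1)
      (ae_of_all _ fun _ => gaussianPDF_lt_top)).1 hf
    simpa [toReal_gaussianPDF] using this
  rw [integral_gaussianReal_eq_integral_smul one_ne_zero,
    integral_gaussianReal_eq_integral_smul one_ne_zero]
  have key := integral_mul_deriv_eq_deriv_mul_of_integrable (u := gaussianPDFReal 0 1) (v := g)
    (u' := fun s => -s * gaussianPDFReal 0 1 s) (v' := g') (fun s _ => hpdf s) (fun s _ => hg s)
    (hint h2) ((hint h1).neg.congr (ae_of_all _ fun s => by simp; ring)) (hint h0)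
  simp only [smul_eq_mul]
  rw [key, ← integral_neg]
  congr 1
  ext s
  ring

theorem integrable_pow_gaussianReal (k : ℕ) :
    Integrable (fun s : ℝ => s ^ k) (gaussianReal 0 1) := by
  rcases Nat.eq_zero_or_pos k with rfl | hk
  · simp
  have h := (memLp_id_gaussianReal' (μ := 0) (v := 1) k (by simp)).integrable_norm_pow hk.ne'
  refine (integrable_norm_iff (by fun_prop)).1 (h.congr (ae_of_all _ fun s => ?_))
  simp

theorem integral_pow_two_gaussianReal : ∫ s : ℝ, s ^ 2 ∂(gaussianReal 0 1) = 1 := by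
  have h := integral_id_mul_gaussianReal (g := fun s => s) (g' := fun _ => 1)
    (fun s => hasDerivAt_id s) (by simpa using integrable_pow_gaussianReal 1)
    (by simpa [sq] using integrable_pow_gaussianReal 2) (integrable_const _)
  simpa [sq] using h

theorem integral_pow_four_gaussianReal : ∫ s : ℝ, s ^ 4 ∂(gaussianReal 0 1) = 3 := by
  have h := integral_id_mul_gaussianReal (g := fun s => s ^ 3) (g' := fun s => 3 * s ^ 2)
    (fun s => by simpa using hasDerivAt_pow 3 s) (integrable_pow_gaussianReal 3)
    ((integrable_pow_gaussianReal 4).congr (ae_of_all _ fun s => by ring))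
    ((integrable_pow_gaussianReal 2).const_mul _)
  rw [integral_const_mul, integral_pow_two_gaussianReal] at h
  calc ∫ s : ℝ, s ^ 4 ∂(gaussianReal 0 1) = ∫ s : ℝ, s * s ^ 3 ∂(gaussianReal 0 1) := by
        congr 1; ext s; ring
    _ = 3 := by rw [h]; norm_num

theorem integrable_norm_pow_stdGaussian (k : ℕ) :
    Integrable (fun z : EuclideanSpace ℝ (Fin n) => ‖z‖ ^ k) (stdGaussian _) := by
  rcases Nat.eq_zero_or_pos k with rfl | hk
  · simp
  exact (IsGaussian.memLp_id (stdGaussian (EuclideanSpace ℝ (Fin n))) k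
    (by simp)).integrable_norm_pow hk.ne'

/-- A continuous function of polynomial growth is integrable against the Gaussian measure. -/
theorem integrable_stdGaussian_of_growth {F : Type*} [NormedAddCommGroup F]
    {g : EuclideanSpace ℝ (Fin n) → F}
    (hg : AEStronglyMeasurable g (stdGaussian _)) (A : ℝ) (k : ℕ)
    (h : ∀ z, ‖g z‖ ≤ A * (1 + ‖z‖) ^ k) : Integrable g (stdGaussian _) := by
  refine Integrable.mono' (g := fun z => A * (1 + ‖z‖) ^ k) ?_ hg (ae_of_all _ h)
  refine Integrable.const_mul ?_ A
  simp_rw [add_comm (1 : ℝ), add_pow]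
  refine integrable_finsetSum _ fun i _ => ?_
  simpa using (integrable_norm_pow_stdGaussian (n := n) i).mul_const _

theorem measurePreserving_eval_stdGaussian (i : Fin n) :
    MeasurePreserving (fun z : EuclideanSpace ℝ (Fin n) => z i) (stdGaussian _)
      (gaussianReal 0 1) := by
  have h := measurePreserving_eval_multivariateGaussian (ι := Fin n) (μ := 0)
    (S := (1 : Matrix (Fin n) (Fin n) ℝ)) Matrix.PosSemidef.one (i := i)
  simpa [multivariateGaussian_zero_one] using h

theorem integral_coord_pow_stdGaussian (i : Fin n) (k : ℕ) :
    ∫ z : EuclideanSpace ℝ (Fin n), z i ^ k ∂(stdGaussian _) = ∫ s, s ^ k ∂(gaussianReal 0 1) := by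
  rw [← (measurePreserving_eval_stdGaussian i).map_eq, integral_map (by fun_prop) (by fun_prop)]

theorem integrable_coord_pow_stdGaussian (i : Fin n) (k : ℕ) :
    Integrable (fun z : EuclideanSpace ℝ (Fin n) => z i ^ k) (stdGaussian _) :=
  (measurePreserving_eval_stdGaussian i).integrable_comp_of_integrable
    (integrable_pow_gaussianReal k)

theorem integral_norm_sq_stdGaussian :
    ∫ z : EuclideanSpace ℝ (Fin n), ‖z‖ ^ 2 ∂(stdGaussian _) = n := by
  simp_rw [EuclideanSpace.real_norm_sq_eq]
  rw [integral_finsetSum _ fun i _ => integrable_coord_pow_stdGaussian i 2]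
  simp_rw [integral_coord_pow_stdGaussian, integral_pow_two_gaussianReal]
  simp

theorem integral_norm_pow_four_stdGaussian_le :
    ∫ z : EuclideanSpace ℝ (Fin n), ‖z‖ ^ 4 ∂(stdGaussian _) ≤ 3 * (n : ℝ) ^ 2 := by
  have hle : ∀ z : EuclideanSpace ℝ (Fin n), ‖z‖ ^ 4 ≤ n * ∑ i, z i ^ 4 := by
    intro z
    have h := sq_sum_le_card_mul_sum_sq (s := Finset.univ) (f := fun i => z i ^ 2)
    rw [← EuclideanSpace.real_norm_sq_eq] at h
    simp only [Finset.card_univ, Fintype.card_fin, ← pow_mul] at h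
    simpa using h
  calc _ ≤ ∫ z : EuclideanSpace ℝ (Fin n), n * ∑ i, z i ^ 4 ∂(stdGaussian _) :=
        integral_mono (integrable_norm_pow_stdGaussian 4)
          ((integrable_finsetSum _ fun i _ => integrable_coord_pow_stdGaussian i 4).const_mul _) hle
    _ = 3 * (n : ℝ) ^ 2 := by
        rw [integral_const_mul, integral_finsetSum _
          fun i _ => integrable_coord_pow_stdGaussian i 4]
        simp_rw [integral_coord_pow_stdGaussian, integral_pow_four_gaussianReal]
        simp; ring

/-- Gaussian integration by parts in a coordinate direction. -/
theorem integral_mul_coord_stdGaussian {g : EuclideanSpace ℝ (Fin n) → ℝ}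
    (hg : Differentiable ℝ g) (hc : Continuous (gradient g)) {A l : ℝ}
    (hA : ∀ z, ‖g z‖ ≤ A * (1 + ‖z‖)) (hl : ∀ z, ‖gradient g z‖ ≤ l) (i : Fin n) :
    ∫ z, z i * g z ∂(stdGaussian _) = ∫ z, gradient g z i ∂(stdGaussian _) := by
  obtain ⟨k, rfl⟩ : ∃ k, n = k + 1 := ⟨n - 1, by have := i.pos; omega⟩
  have hA0 : 0 ≤ A := by simpa using (norm_nonneg _).trans (hA 0)
  have hcoord : ∀ (z : EuclideanSpace ℝ (Fin (k + 1))) j, |z j| ≤ ‖z‖ := fun z j => by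
    simpa using PiLp.norm_apply_le z j
  -- The i-th coordinate is independent of the others. Fubini then leaves, for almost every value of
  -- the others, an integral over a line parallel to the i-th axis.
  have hmp : MeasurePreserving (fun p : ℝ × (Fin k → ℝ) => WithLp.toLp 2 (i.insertNth p.1 p.2))
      ((gaussianReal 0 1).prod (Measure.pi fun _ => gaussianReal 0 1))
      (stdGaussian (EuclideanSpace ℝ (Fin (k + 1)))) := by
    have h1 := (measurePreserving_piFinSuccAbove
      (fun _ : Fin (k + 1) => gaussianReal 0 1) i).symm
    have h2 : MeasurePreserving (WithLp.toLp 2) (Measure.pi fun _ : Fin (k + 1) => gaussianReal 0 1)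
      (stdGaussian (EuclideanSpace ℝ (Fin (k + 1)))) := ⟨by fun_prop, map_pi_eq_stdGaussian⟩
    exact h2.comp h1
  have hi1 : Integrable (fun z => z i * g z) (stdGaussian (EuclideanSpace ℝ (Fin (k + 1)))) := by
    refine integrable_stdGaussian_of_growth
      (by have := hg.continuous; fun_prop) A 2 fun z => ?_
    rw [norm_mul]
    have h1 : ‖z i‖ ≤ 1 + ‖z‖ := by have := hcoord z i; simp only [Real.norm_eq_abs]; linarith
    calc _ ≤ (1 + ‖z‖) * (A * (1 + ‖z‖)) := by gcongr; exact hA z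
      _ = _ := by ring
  have hi2 : Integrable (fun z => gradient g z i)
      (stdGaussian (EuclideanSpace ℝ (Fin (k + 1)))) := by
    refine integrable_stdGaussian_of_growth (by fun_prop) l 0 fun z => ?_
    simpa using (hcoord _ i).trans (hl z)
  have hi0 : Integrable g (stdGaussian (EuclideanSpace ℝ (Fin (k + 1)))) :=
    integrable_stdGaussian_of_growth (hg.continuous.aestronglyMeasurable) A 1 (by simpa using hA)
  have hj1 := hmp.integrable_comp_of_integrable hi1
  have hj2 := hmp.integrable_comp_of_integrable hi2
  have hj0 := hmp.integrable_comp_of_integrable hi0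
  rw [← hmp.map_eq, integral_map hmp.measurable.aemeasurable (hmp.map_eq ▸ hi1.1),
    integral_map hmp.measurable.aemeasurable (hmp.map_eq ▸ hi2.1)]
  refine (integral_prod_symm _ hj1).trans (Eq.trans ?_ (integral_prod_symm _ hj2).symm)
  refine integral_congr_ae ?_
  filter_upwards [hj1.prod_left_ae, hj2.prod_left_ae, hj0.prod_left_ae] with v h1 h2 h0
  have hline : ∀ s : ℝ, HasDerivAt (fun s : ℝ => WithLp.toLp 2 (i.insertNth s v))
      (EuclideanSpace.single i (1 : ℝ)) s := by
    intro s
    have hrepr : (fun s : ℝ => (WithLp.toLp 2 (i.insertNth s v) : EuclideanSpace ℝ (Fin (k + 1)))) =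
        fun s => WithLp.toLp 2 (i.insertNth 0 v) + s • EuclideanSpace.single i (1 : ℝ) := by
      funext s
      ext j
      refine i.succAboveCases ?_ (fun j => ?_) j <;> simp
    rw [hrepr]
    simpa using ((hasDerivAt_id s).smul_const (EuclideanSpace.single i (1 : ℝ))).const_add
      (WithLp.toLp 2 (i.insertNth 0 v))
  have := integral_id_mul_gaussianReal
    (g := fun s => g (WithLp.toLp 2 (i.insertNth s v)))
    (g' := fun s => gradient g (WithLp.toLp 2 (i.insertNth s v)) i) (fun s => ?_) h0
    (by simpa using h1) h2
  · simpa using this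
  · have hF := (hg (WithLp.toLp 2 (i.insertNth s v))).hasGradientAt.hasFDerivAt
    have := hF.comp_hasDerivAt s (hline s)
    refine this.congr_deriv ?_
    rw [InnerProductSpace.toDual_apply_apply, EuclideanSpace.inner_single_right]
    simp

/-- Gaussian integration by parts. -/
theorem integral_mul_inner_stdGaussian {g : EuclideanSpace ℝ (Fin n) → ℝ}
    (hg : Differentiable ℝ g) (hc : Continuous (gradient g)) {A l : ℝ}
    (hA : ∀ z, ‖g z‖ ≤ A * (1 + ‖z‖)) (hl : ∀ z, ‖gradient g z‖ ≤ l)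
    (w : EuclideanSpace ℝ (Fin n)) :
    ∫ z, g z * inner ℝ z w ∂(stdGaussian _) = ∫ z, inner ℝ (gradient g z) w ∂(stdGaussian _) := by
  have hA0 : 0 ≤ A := by simpa using (norm_nonneg _).trans (hA 0)
  have hcoord : ∀ (z : EuclideanSpace ℝ (Fin n)) j, |z j| ≤ ‖z‖ := fun z j => by
    simpa using PiLp.norm_apply_le z j
  have hi1 : ∀ i, Integrable (fun z => z i * g z) (stdGaussian (EuclideanSpace ℝ (Fin n))) := by
    intro i
    refine integrable_stdGaussian_of_growth
      (by have := hg.continuous; fun_prop) A 2 fun z => ?_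
    rw [norm_mul]
    have h1 : ‖z i‖ ≤ 1 + ‖z‖ := by have := hcoord z i; simp only [Real.norm_eq_abs]; linarith
    calc _ ≤ (1 + ‖z‖) * (A * (1 + ‖z‖)) := by gcongr; exact hA z
      _ = _ := by ring
  have hi2 : ∀ i, Integrable (fun z => gradient g z i)
      (stdGaussian (EuclideanSpace ℝ (Fin n))) := by
    intro i
    refine integrable_stdGaussian_of_growth (by fun_prop) l 0 fun z => ?_
    simpa using (hcoord _ i).trans (hl z)
  have e1 : ∀ z, g z * inner ℝ z w = ∑ i, w i * (z i * g z) := by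
    intro z
    simp only [PiLp.inner_apply, Finset.mul_sum, RCLike.inner_apply, conj_trivial]
    exact Finset.sum_congr rfl fun i _ => by ring
  have e2 : ∀ z, inner ℝ (gradient g z) w = ∑ i, w i * gradient g z i := by
    intro z
    simp only [PiLp.inner_apply, RCLike.inner_apply, conj_trivial]
  simp_rw [e1, e2]
  rw [integral_finsetSum _ fun i _ => (hi1 i).const_mul _,
    integral_finsetSum _ fun i _ => (hi2 i).const_mul _]
  refine Finset.sum_congr rfl fun i _ => ?_
  rw [integral_const_mul, integral_const_mul, integral_mul_coord_stdGaussian hg hc hA hl]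

/-! ### Inequalities for a single cost function -/

/-- The conditions of `CostClass` on a single cost function. -/
structure RegularCost (n : ℕ) (K l L m : ℝ) (f : EuclideanSpace ℝ (Fin n) → ℝ) : Prop where
  convex : ConvexOn ℝ Set.univ f
  differentiable : Differentiable ℝ f
  gradient_bound : ∀ y, ‖gradient f y‖ ≤ l
  gradient_lipschitz : ∀ y z, ‖gradient f y - gradient f z‖ ≤ L * ‖y - z‖
  inner_pos : ∀ y, K < ‖y‖ ^ 2 → 0 < inner ℝ y (gradient f y)
  value_bound : |f 0| ≤ m

theorem CostClass.regularCost {K l L m : ℝ} {c : ℕ → EuclideanSpace ℝ (Fin n) → ℝ}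
    (h : CostClass n K l L m c) {t : ℕ} (ht : 1 ≤ t) : RegularCost n K l L m (c t) :=
  ⟨h.convex t ht, h.differentiable t ht, h.gradient_bound t ht, h.gradient_lipschitz t ht,
    h.inner_pos t ht, h.value_bound t ht⟩

namespace RegularCost

variable {K l L m : ℝ} {f : EuclideanSpace ℝ (Fin n) → ℝ}

theorem l_nonneg (h : RegularCost n K l L m f) : 0 ≤ l :=
  (norm_nonneg _).trans (h.gradient_bound 0)

theorem m_nonneg (h : RegularCost n K l L m f) : 0 ≤ m :=
  (abs_nonneg _).trans h.value_bound

/-- In dimension 0 the Lipschitz condition says nothing about L; a unit vector is needed. -/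
theorem L_nonneg (h : RegularCost n K l L m f) (hn : 1 ≤ n) : 0 ≤ L := by
  have := h.gradient_lipschitz (EuclideanSpace.single ⟨0, hn⟩ 1) 0
  simp only [sub_zero, PiLp.norm_single, norm_one, mul_one] at this
  exact (norm_nonneg _).trans this

theorem continuous_gradient (h : RegularCost n K l L m f) : Continuous (gradient f) := by
  refine (LipschitzWith.of_dist_le_mul (K := |L|.toNNReal) fun y z => ?_).continuous
  rw [dist_eq_norm, dist_eq_norm, Real.coe_toNNReal _ (abs_nonneg L)]
  exact (h.gradient_lipschitz y z).trans (by gcongr; exact le_abs_self L)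

/-- On the segment from x to y, the slope of a convex function of one variable is at least its
derivative at the left end. -/
theorem add_inner_le (h : RegularCost n K l L m f) (x y : EuclideanSpace ℝ (Fin n)) :
    f x + inner ℝ (gradient f x) (y - x) ≤ f y := by
  have hconv : ConvexOn ℝ Set.univ (f ∘ AffineMap.lineMap (k := ℝ) x y) := by
    simpa using h.convex.comp_affineMap (AffineMap.lineMap (k := ℝ) x y)
  have hx : HasFDerivAt f (InnerProductSpace.toDual ℝ _ (gradient f x))
      (AffineMap.lineMap (k := ℝ) x y 0) := by
    simpa using (h.differentiable x).hasGradientAt.hasFDerivAt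
  have hd : HasDerivAt (f ∘ AffineMap.lineMap (k := ℝ) x y) (inner ℝ (gradient f x) (y - x)) 0 := by
    have := hx.comp_hasDerivAt (0 : ℝ) AffineMap.hasDerivAt_lineMap
    rwa [InnerProductSpace.toDual_apply_apply] at this
  have := hconv.le_slope_of_hasDerivAt (Set.mem_univ 0) (Set.mem_univ 1) one_pos hd
  simp only [slope_def_field, Function.comp, AffineMap.lineMap_apply_one,
    AffineMap.lineMap_apply_zero, sub_zero, div_one] at this
  linarith

theorem abs_le (h : RegularCost n K l L m f) (x : EuclideanSpace ℝ (Fin n)) :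
    |f x| ≤ m + l * ‖x‖ := by
  have h1 := h.add_inner_le x 0
  have h2 := h.add_inner_le 0 x
  have h3 := abs_real_inner_le_norm (gradient f x) (0 - x)
  have h4 := abs_real_inner_le_norm (gradient f 0) (x - 0)
  have h5 : ‖gradient f x‖ * ‖x‖ ≤ l * ‖x‖ := by gcongr; exact h.gradient_bound x
  have h6 : ‖gradient f 0‖ * ‖x‖ ≤ l * ‖x‖ := by gcongr; exact h.gradient_bound 0
  have h7 := h.value_bound
  simp only [zero_sub, norm_neg, sub_zero] at h3 h4 h1 h2
  rw [_root_.abs_le] at h3 h4 h7 ⊢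
  constructor <;> linarith

theorem abs_comp_le (h : RegularCost n K l L m f) {σ : ℝ} (hσ : 0 ≤ σ)
    (u z : EuclideanSpace ℝ (Fin n)) : |f (u + σ • z)| ≤ m + l * (‖u‖ + σ * ‖z‖) := by
  refine (h.abs_le _).trans ?_
  have := h.l_nonneg
  gcongr
  refine (norm_add_le _ _).trans ?_
  rw [norm_smul, Real.norm_of_nonneg hσ]

theorem abs_comp_le_growth (h : RegularCost n K l L m f) {σ : ℝ} (hσ : 0 ≤ σ)
    (u z : EuclideanSpace ℝ (Fin n)) :
    |f (u + σ • z)| ≤ (m + l * (‖u‖ + σ)) * (1 + ‖z‖) := by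
  refine (h.abs_comp_le hσ u z).trans ?_
  have h1 := h.l_nonneg
  have h2 := h.m_nonneg
  nlinarith [norm_nonneg z, norm_nonneg u, mul_nonneg h2 (norm_nonneg z), mul_nonneg h1 hσ,
    mul_nonneg (mul_nonneg h1 (norm_nonneg u)) (norm_nonneg z)]

/-- Freezing the gradient at u leaves a term linear in z, which has Gaussian mean zero, so smoothing
costs order σ² and not σ. -/
theorem inner_gradient_sub_le (h : RegularCost n K l L m f) {σ : ℝ} (hσ : 0 ≤ σ)
    (u z : EuclideanSpace ℝ (Fin n)) :
    σ * inner ℝ (gradient f (u + σ • z)) z ≤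
      σ * inner ℝ (gradient f u) z + L * σ ^ 2 * ‖z‖ ^ 2 := by
  have h1 := real_inner_le_norm (gradient f (u + σ • z) - gradient f u) z
  have h2 := h.gradient_lipschitz (u + σ • z) u
  rw [add_sub_cancel_left, norm_smul, Real.norm_of_nonneg hσ] at h2
  rw [inner_sub_left] at h1
  have h3 : inner ℝ (gradient f (u + σ • z)) z - inner ℝ (gradient f u) z ≤
      L * (σ * ‖z‖) * ‖z‖ := h1.trans (by gcongr)
  have := mul_le_mul_of_nonneg_left h3 hσ
  linarith

theorem integrable_comp (h : RegularCost n K l L m f) {σ : ℝ} (hσ : 0 ≤ σ)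
    (u : EuclideanSpace ℝ (Fin n)) :
    Integrable (fun z => f (u + σ • z)) (stdGaussian (EuclideanSpace ℝ (Fin n))) := by
  have hc := h.differentiable.continuous
  refine integrable_stdGaussian_of_growth (by fun_prop) (m + l * (‖u‖ + σ)) 1 fun z => ?_
  simpa using h.abs_comp_le_growth hσ u z

theorem integrable_inner_gradient (h : RegularCost n K l L m f) (σ : ℝ)
    (u w : EuclideanSpace ℝ (Fin n)) :
    Integrable (fun z => inner ℝ (gradient f (u + σ • z)) w)
      (stdGaussian (EuclideanSpace ℝ (Fin n))) := by
  have hc := h.continuous_gradient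
  refine integrable_stdGaussian_of_growth (by fun_prop) (l * ‖w‖) 0 fun z => ?_
  simp only [pow_zero, mul_one]
  refine (abs_real_inner_le_norm _ _).trans ?_
  gcongr
  exact h.gradient_bound _

/-- Integration by parts for z ↦ f(u+σz), whose gradient is σ∇f(u+σz). It is what makes f(x)(x-u)/σ²
an unbiased estimator of the smoothed gradient. -/
theorem integral_comp_mul_inner (h : RegularCost n K l L m f) {σ : ℝ} (hσ : 0 ≤ σ)
    (u w : EuclideanSpace ℝ (Fin n)) :
    ∫ z, f (u + σ • z) * inner ℝ z w ∂(stdGaussian _) =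
      σ * ∫ z, inner ℝ (gradient f (u + σ • z)) w ∂(stdGaussian _) := by
  have hgrad : ∀ z, HasGradientAt (fun z => f (u + σ • z)) (σ • gradient f (u + σ • z)) z := by
    intro z
    have h1 := (h.differentiable (u + σ • z)).hasGradientAt.hasFDerivAt
    have h2 : HasFDerivAt (fun z : EuclideanSpace ℝ (Fin n) => u + σ • z)
      (σ • ContinuousLinearMap.id ℝ _) z := ((hasFDerivAt_id z).const_smul σ).const_add u
    refine (h1.comp z h2).congr_fderiv ?_
    ext v
    simp
  have hg : gradient (fun z => f (u + σ • z)) = fun z => σ • gradient f (u + σ • z) :=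
    funext fun z => (hgrad z).gradient
  have hc := h.continuous_gradient
  rw [integral_mul_inner_stdGaussian (g := fun z => f (u + σ • z))
    (fun z => (hgrad z).differentiableAt) (by rw [hg]; fun_prop)
    (fun z => h.abs_comp_le_growth hσ u z) (l := σ * l), hg, ← integral_const_mul]
  · simp [inner_smul_left]
  · intro z
    rw [hg, norm_smul, Real.norm_of_nonneg hσ]
    gcongr
    exact h.gradient_bound _

theorem integral_inner_stdGaussian (w : EuclideanSpace ℝ (Fin n)) :
    ∫ z, inner ℝ w z ∂(stdGaussian (EuclideanSpace ℝ (Fin n))) = 0 := by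
  simpa using integral_strongDual_stdGaussian (E := EuclideanSpace ℝ (Fin n)) (innerSL ℝ w)

theorem integrable_inner_stdGaussian (w : EuclideanSpace ℝ (Fin n)) :
    Integrable (fun z => inner ℝ w z) (stdGaussian (EuclideanSpace ℝ (Fin n))) :=
  IsGaussian.integrable_dual (stdGaussian (EuclideanSpace ℝ (Fin n))) (innerSL ℝ w)

/-- The gradient estimator correlates with `u - y` at least as much as the regret at `u`. -/
theorem le_integral_comp_mul_inner (h : RegularCost n K l L m f) {σ : ℝ} (hσ : 0 ≤ σ)
    (u y : EuclideanSpace ℝ (Fin n)) :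
    σ * (∫ z, f (u + σ • z) ∂(stdGaussian _) - f y - L * σ ^ 2 * n) ≤
      ∫ z, f (u + σ • z) * inner ℝ z (u - y) ∂(stdGaussian _) := by
  rw [h.integral_comp_mul_inner hσ]
  gcongr
  have i1 := h.integrable_comp hσ u
  have i2 := (integrable_inner_stdGaussian (gradient f y)).const_mul σ
  have i3 := (integrable_norm_pow_stdGaussian (n := n) 2).const_mul (L * σ ^ 2)
  have i4 := h.integrable_inner_gradient σ u (u - y)
  -- Convexity is used twice: from u+σz to y+σz, whose difference u - y is free of z, and from y+σz
  -- to y.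
  have hpt : ∀ z, f (u + σ • z) - f y ≤ inner ℝ (gradient f (u + σ • z)) (u - y) +
      (σ * inner ℝ (gradient f y) z + L * σ ^ 2 * ‖z‖ ^ 2) := by
    intro z
    have h1 := h.add_inner_le (u + σ • z) (y + σ • z)
    have h2 := h.add_inner_le (y + σ • z) y
    have h3 := h.inner_gradient_sub_le hσ y z
    rw [add_sub_add_right_eq_sub, ← neg_sub, inner_neg_right] at h1
    rw [sub_add_cancel_left, inner_neg_right, inner_smul_right] at h2
    linarith
  have i5 : Integrable (fun z => σ * inner ℝ (gradient f y) z + L * σ ^ 2 * ‖z‖ ^ 2)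
      (stdGaussian (EuclideanSpace ℝ (Fin n))) := i2.add i3
  have := integral_mono (i1.sub (integrable_const (f y))) (i4.add i5) hpt
  simp only [Pi.sub_apply, Pi.add_apply] at this
  rw [integral_sub i1 (integrable_const _), integral_add i4 i5, integral_add i2 i3,
    integral_const_mul, integral_const_mul, integral_inner_stdGaussian,
    integral_norm_sq_stdGaussian] at this
  simp only [integral_const, probReal_univ, one_smul, mul_zero, zero_add] at this
  linarith

theorem sq_mul_norm_sq_le (h : RegularCost n K l L m f) {σ : ℝ} (hσ : 0 ≤ σ)
    (u z : EuclideanSpace ℝ (Fin n)) :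
    f (u + σ • z) ^ 2 * ‖z‖ ^ 2 ≤
      (2 * m ^ 2 + 4 * l ^ 2 * ‖u‖ ^ 2) * ‖z‖ ^ 2 + 4 * l ^ 2 * σ ^ 2 * ‖z‖ ^ 4 := by
  have h1 : f (u + σ • z) ^ 2 ≤ (m + l * (‖u‖ + σ * ‖z‖)) ^ 2 :=
    sq_le_sq' (by linarith [neg_abs_le (f (u + σ • z)), h.abs_comp_le hσ u z])
      ((le_abs_self _).trans (h.abs_comp_le hσ u z))
  have h2 : (m + l * (‖u‖ + σ * ‖z‖)) ^ 2 ≤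
      2 * m ^ 2 + 4 * l ^ 2 * ‖u‖ ^ 2 + 4 * l ^ 2 * σ ^ 2 * ‖z‖ ^ 2 := by
    nlinarith [sq_nonneg (m - l * (‖u‖ + σ * ‖z‖)), sq_nonneg (l * (‖u‖ - σ * ‖z‖))]
  calc _ ≤ (2 * m ^ 2 + 4 * l ^ 2 * ‖u‖ ^ 2 + 4 * l ^ 2 * σ ^ 2 * ‖z‖ ^ 2) * ‖z‖ ^ 2 := by
        gcongr; exact h1.trans h2
    _ = _ := by ring

theorem integral_sq_mul_norm_sq_le (h : RegularCost n K l L m f) {σ : ℝ} (hσ : 0 ≤ σ)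
    (u : EuclideanSpace ℝ (Fin n)) :
    ∫ z, f (u + σ • z) ^ 2 * ‖z‖ ^ 2 ∂(stdGaussian _) ≤
      2 * m ^ 2 * n + 4 * l ^ 2 * n * ‖u‖ ^ 2 + 12 * l ^ 2 * n ^ 2 * σ ^ 2 := by
  have i1 := (integrable_norm_pow_stdGaussian (n := n) 2).const_mul
    (2 * m ^ 2 + 4 * l ^ 2 * ‖u‖ ^ 2)
  have i2 := (integrable_norm_pow_stdGaussian (n := n) 4).const_mul (4 * l ^ 2 * σ ^ 2)
  have := integral_mono_of_nonneg (μ := stdGaussian (EuclideanSpace ℝ (Fin n)))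
    (ae_of_all _ fun z => by positivity) (i1.add i2)
    (ae_of_all _ fun z => h.sq_mul_norm_sq_le hσ u z)
  rw [integral_add' i1 i2, integral_const_mul, integral_const_mul,
    integral_norm_sq_stdGaussian] at this
  have h4 : 4 * l ^ 2 * σ ^ 2 * ∫ z : EuclideanSpace ℝ (Fin n), ‖z‖ ^ 4 ∂(stdGaussian _) ≤
      4 * l ^ 2 * σ ^ 2 * (3 * (n : ℝ) ^ 2) := by
    gcongr; exact integral_norm_pow_four_stdGaussian_le
  linarith

/-- Far from the origin the smoothed gradient points outwards, up to a small error. -/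
theorem le_integral_inner_gradient (h : RegularCost n K l L m f) (hK : 0 < K) {σ : ℝ}
    (hσ : 0 ≤ σ) {u : EuclideanSpace ℝ (Fin n)} (hu : 2 * √K ≤ ‖u‖) (j : ℕ) :
    -(L * σ ^ 2 * n + l * √K * (σ / √K) ^ j *
        ∫ z : EuclideanSpace ℝ (Fin n), ‖z‖ ^ j ∂(stdGaussian _)) ≤
      ∫ z, inner ℝ (gradient f (u + σ • z)) u ∂(stdGaussian _) := by
  have hK' : 0 < √K := Real.sqrt_pos.2 hK
  have hl := h.l_nonneg
  have i1 := h.integrable_inner_gradient σ u u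
  have i2 := (integrable_inner_stdGaussian (gradient f u)).const_mul σ
  have i3 := (integrable_norm_pow_stdGaussian (n := n) 2).const_mul (L * σ ^ 2)
  have i4 := (integrable_norm_pow_stdGaussian (n := n) j).const_mul (l * √K * (σ / √K) ^ j)
  have hpt : ∀ z, 0 ≤ inner ℝ (gradient f (u + σ • z)) u + ((σ * inner ℝ (gradient f u) z +
      L * σ ^ 2 * ‖z‖ ^ 2) + l * √K * (σ / √K) ^ j * ‖z‖ ^ j) := by
    intro z
    have h1 := h.inner_gradient_sub_le hσ u z
    -- If the query point falls back into the ball of radius √K although ‖u‖ ≥ 2√K, then σ‖z‖ ≥ √K.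
    -- The indicator of this event is at most (σ‖z‖/√K)^j, as in Markov's inequality, with j at
    -- choice.
    have h2 : -(l * √K * (σ / √K) ^ j * ‖z‖ ^ j) ≤
        inner ℝ (gradient f (u + σ • z)) (u + σ • z) := by
      by_cases hx : K < ‖u + σ • z‖ ^ 2
      · have h3 := h.inner_pos _ hx
        rw [real_inner_comm] at h3
        have : 0 ≤ l * √K * (σ / √K) ^ j * ‖z‖ ^ j := by positivity
        linarith
      · have hx' : ‖u + σ • z‖ ≤ √K := Real.le_sqrt_of_sq_le (not_lt.1 hx)
        have h4 : ‖u‖ ≤ ‖u + σ • z‖ + σ * ‖z‖ := by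
          have := norm_sub_le (u + σ • z) (σ • z)
          rwa [add_sub_cancel_right, norm_smul, Real.norm_of_nonneg hσ] at this
        have h5 : 1 ≤ (σ / √K) * ‖z‖ := by
          rw [div_mul_eq_mul_div, le_div_iff₀ hK']
          linarith
        have h6 : 1 ≤ (σ / √K) ^ j * ‖z‖ ^ j := by
          rw [← mul_pow]; exact one_le_pow₀ h5
        have h7 : |inner ℝ (gradient f (u + σ • z)) (u + σ • z)| ≤ l * √K :=
          (abs_real_inner_le_norm _ _).trans
            (mul_le_mul (h.gradient_bound _) hx' (norm_nonneg _) hl)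
        have h8 : l * √K * 1 ≤ l * √K * ((σ / √K) ^ j * ‖z‖ ^ j) := by gcongr
        have := neg_abs_le (inner ℝ (gradient f (u + σ • z)) (u + σ • z))
        linarith
    rw [inner_add_right, inner_smul_right] at h2
    linarith
  have := integral_nonneg_of_ae (μ := stdGaussian (EuclideanSpace ℝ (Fin n))) (ae_of_all _ hpt)
  have i5 : Integrable (fun z => σ * inner ℝ (gradient f u) z + L * σ ^ 2 * ‖z‖ ^ 2)
      (stdGaussian (EuclideanSpace ℝ (Fin n))) := i2.add i3
  have i6 : Integrable (fun z => (σ * inner ℝ (gradient f u) z + L * σ ^ 2 * ‖z‖ ^ 2) +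
      l * √K * (σ / √K) ^ j * ‖z‖ ^ j) (stdGaussian (EuclideanSpace ℝ (Fin n))) := i5.add i4
  rw [integral_add i1 i6, integral_add i5 i4, integral_add i2 i3,
    integral_const_mul, integral_const_mul, integral_const_mul, integral_inner_stdGaussian,
    integral_norm_sq_stdGaussian] at this
  linarith

end RegularCost

/-! ### One step of the algorithm -/

instance isMarkovKernel_queryKernel (σ : ℝ) : IsMarkovKernel (queryKernel n σ) :=
  Kernel.IsMarkovKernel.map _ (by fun_prop)

theorem queryKernel_apply (σ : ℝ) (v : EuclideanSpace ℝ (Fin n)) :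
    queryKernel n σ v = (stdGaussian (EuclideanSpace ℝ (Fin n))).map (fun z => v + σ • z) := by
  rw [queryKernel, Kernel.map_apply _ (by fun_prop), Kernel.prod_apply, Kernel.id_apply,
    Kernel.const_apply, Measure.dirac_prod, Measure.map_map (by fun_prop) (by fun_prop)]
  rfl

/-- Querying amounts to adding independent Gaussian noise, so expectations over a step become
integrals for a product measure, open to Fubini. -/
theorem compProd_queryKernel (ν : Measure (EuclideanSpace ℝ (Fin n))) [IsProbabilityMeasure ν]
    (σ : ℝ) :
    ν ⊗ₘ queryKernel n σ =
      (ν.prod (stdGaussian (EuclideanSpace ℝ (Fin n)))).map (fun p => (p.1, p.1 + σ • p.2)) := by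
  have hm : Measurable fun p : EuclideanSpace ℝ (Fin n) × EuclideanSpace ℝ (Fin n) =>
    (p.1, p.1 + σ • p.2) := by fun_prop
  ext s hs
  rw [Measure.compProd_apply hs, Measure.map_apply hm hs, Measure.prod_apply (hm hs)]
  congr 1
  ext v
  rw [queryKernel_apply, Measure.map_apply (by fun_prop) (measurable_prodMk_left hs)]
  rfl

/-- One step `X ↦ X'` of the algorithm for the cost `f`, with query point `Y`. -/
structure GaussianStep (f : EuclideanSpace ℝ (Fin n) → ℝ) (α σ : ℝ) {Ω : Type u}
    [MeasurableSpace Ω] (P : Measure Ω) (X Y X' : Ω → EuclideanSpace ℝ (Fin n)) : Prop where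
  aemeasurable : AEMeasurable (fun ω => (X ω, Y ω)) P
  map_eq : P.map (fun ω => (X ω, Y ω)) =
    ((P.map X).prod (stdGaussian (EuclideanSpace ℝ (Fin n)))).map (fun p => (p.1, p.1 + σ • p.2))
  update : ∀ᵐ ω ∂P, X' ω = X ω - (α * f (Y ω) / σ ^ 2) • (Y ω - X ω)

/-- The kernel sees the history only through μ_t, so conditioning on the history may be replaced by
conditioning on μ_t. -/
theorem OnePointRun.gaussianStep {a b : ℝ} {c : ℕ → EuclideanSpace ℝ (Fin n) → ℝ}
    {μ₁ : EuclideanSpace ℝ (Fin n)} {Ω : Type u} [MeasurableSpace Ω] {P : Measure Ω}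
    [IsProbabilityMeasure P] {μ x : ℕ → Ω → EuclideanSpace ℝ (Fin n)}
    (h : OnePointRun a b c μ₁ P μ x) {t : ℕ} (ht : 1 ≤ t) :
    GaussianStep (c t) (stepSize a n t) (querySd b n t) P (μ t) (x t) (μ (t + 1)) := by
  have h1 : HasCondDistrib (x t) (μ t) (queryKernel n (querySd b n t)) P := (h.query t ht).comp_right
  have : IsProbabilityMeasure (P.map (μ t)) := Measure.isProbabilityMeasure_map h1.aemeasurable_fst
  exact ⟨h1.aemeasurable, by rw [h1.map_eq, compProd_queryKernel], h.update t ht⟩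

namespace GaussianStep

variable {f : EuclideanSpace ℝ (Fin n) → ℝ} {α σ : ℝ} {Ω : Type u} [MeasurableSpace Ω]
  {P : Measure Ω} {X Y X' : Ω → EuclideanSpace ℝ (Fin n)}
  {K l L m : ℝ}

theorem integral_eq (h : GaussianStep f α σ P X Y X')
    {ψ : EuclideanSpace ℝ (Fin n) × EuclideanSpace ℝ (Fin n) → ℝ} (hψ : Measurable ψ) :
    ∫ ω, ψ (X ω, Y ω) ∂P = ∫ p, ψ (p.1, p.1 + σ • p.2) ∂((P.map X).prod (stdGaussian _)) := by
  rw [← integral_map h.aemeasurable hψ.aestronglyMeasurable, h.map_eq,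
    integral_map (by fun_prop) hψ.aestronglyMeasurable]

theorem integrable_iff (h : GaussianStep f α σ P X Y X')
    {ψ : EuclideanSpace ℝ (Fin n) × EuclideanSpace ℝ (Fin n) → ℝ} (hψ : Measurable ψ) :
    Integrable (fun ω => ψ (X ω, Y ω)) P ↔
      Integrable (fun p => ψ (p.1, p.1 + σ • p.2)) ((P.map X).prod (stdGaussian _)) := by
  have h1 := integrable_map_measure (μ := P) (g := ψ) hψ.aestronglyMeasurable h.aemeasurable
  rw [h.map_eq, integrable_map_measure hψ.aestronglyMeasurable (by fun_prop)] at h1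
  exact h1.symm

theorem aemeasurable_fst (h : GaussianStep f α σ P X Y X') : AEMeasurable X P :=
  h.aemeasurable.fst

theorem aestronglyMeasurable_displacement (h : GaussianStep f α σ P X Y X')
    (hf : RegularCost n K l L m f) :
    AEStronglyMeasurable (fun ω => (α * f (Y ω) / σ ^ 2) • (Y ω - X ω)) P := by
  have hc := hf.differentiable.continuous
  have hm : Measurable fun p : EuclideanSpace ℝ (Fin n) × EuclideanSpace ℝ (Fin n) =>
    (α * f p.2 / σ ^ 2) • (p.2 - p.1) := by fun_prop
  exact (hm.comp_aemeasurable h.aemeasurable).aestronglyMeasurable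

theorem memLp_map (h : GaussianStep f α σ P X Y X') (hX : MemLp X 2 P) :
    MemLp id 2 (P.map X) :=
  (memLp_map_measure_iff aestronglyMeasurable_id h.aemeasurable_fst).2 hX

theorem integrable_norm_sq (h : GaussianStep f α σ P X Y X') (hX : MemLp X 2 P) :
    Integrable (fun v => ‖v‖ ^ 2) (P.map X) :=
  (h.memLp_map hX).integrable_norm_pow two_ne_zero

variable [IsProbabilityMeasure P]

theorem isProbabilityMeasure_map (h : GaussianStep f α σ P X Y X') :
    IsProbabilityMeasure (P.map X) := Measure.isProbabilityMeasure_map h.aemeasurable_fst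

theorem integrable_norm (h : GaussianStep f α σ P X Y X') (hX : MemLp X 2 P) :
    Integrable (fun v => ‖v‖) (P.map X) := by
  have := h.isProbabilityMeasure_map
  exact ((h.memLp_map hX).integrable one_le_two).norm

theorem integrable_prod_cost (h : GaussianStep f α σ P X Y X') (hX : MemLp X 2 P)
    (hf : RegularCost n K l L m f) (hσ : 0 ≤ σ) :
    Integrable (fun p : EuclideanSpace ℝ (Fin n) × EuclideanSpace ℝ (Fin n) => f (p.1 + σ • p.2))
      ((P.map X).prod (stdGaussian _)) := by
  have := h.isProbabilityMeasure_map
  have hc := hf.differentiable.continuous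
  have i1 := (h.integrable_norm hX).comp_fst (stdGaussian (EuclideanSpace ℝ (Fin n)))
  have i2 := (integrable_norm_pow_stdGaussian (n := n) 1).comp_snd (P.map X)
  refine Integrable.mono' (((integrable_const m).add ((i1.add (i2.const_mul σ)).const_mul l)))
    (by fun_prop) (ae_of_all _ fun p => ?_)
  simpa using hf.abs_comp_le hσ p.1 p.2

theorem integrable_cost (h : GaussianStep f α σ P X Y X') (hX : MemLp X 2 P)
    (hf : RegularCost n K l L m f) (hσ : 0 ≤ σ) : Integrable (fun ω => f (Y ω)) P := by
  have hc := hf.differentiable.continuous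
  exact (h.integrable_iff (ψ := fun p => f p.2) (by fun_prop)).2 (h.integrable_prod_cost hX hf hσ)

theorem integral_cost (h : GaussianStep f α σ P X Y X') (hX : MemLp X 2 P)
    (hf : RegularCost n K l L m f) (hσ : 0 ≤ σ) :
    ∫ ω, f (Y ω) ∂P = ∫ v, ∫ z, f (v + σ • z) ∂(stdGaussian _) ∂(P.map X) := by
  have := h.isProbabilityMeasure_map
  have hc := hf.differentiable.continuous
  rw [h.integral_eq (ψ := fun p => f p.2) (by fun_prop),
    integral_prod _ (h.integrable_prod_cost hX hf hσ)]

/-- Linear growth of f leaves only a quadratic dependence on X, so a second moment of X suffices and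
square integrability passes from step to step. -/
theorem integrable_prod_sq (h : GaussianStep f α σ P X Y X') (hX : MemLp X 2 P)
    (hf : RegularCost n K l L m f) (hσ : 0 ≤ σ) :
    Integrable (fun p : EuclideanSpace ℝ (Fin n) × EuclideanSpace ℝ (Fin n) =>
      f (p.1 + σ • p.2) ^ 2 * ‖p.2‖ ^ 2) ((P.map X).prod (stdGaussian _)) := by
  have := h.isProbabilityMeasure_map
  have hc := hf.differentiable.continuous
  have i1 : Integrable (fun v : EuclideanSpace ℝ (Fin n) => 2 * m ^ 2 + 4 * l ^ 2 * ‖v‖ ^ 2)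
    (P.map X) := (integrable_const _).add ((h.integrable_norm_sq hX).const_mul _)
  have i2 := i1.mul_prod (integrable_norm_pow_stdGaussian (n := n) 2)
  have i3 := ((integrable_norm_pow_stdGaussian (n := n) 4).const_mul (4 * l ^ 2 * σ ^ 2)).comp_snd
    (P.map X)
  refine Integrable.mono' (i2.add i3) (by fun_prop) (ae_of_all _ fun p => ?_)
  rw [Real.norm_of_nonneg (by positivity)]
  exact hf.sq_mul_norm_sq_le hσ p.1 p.2

theorem integrable_sq_displacement (h : GaussianStep f α σ P X Y X') (hX : MemLp X 2 P)
    (hf : RegularCost n K l L m f) (hσ : 0 < σ) :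
    Integrable (fun ω => ‖(α * f (Y ω) / σ ^ 2) • (Y ω - X ω)‖ ^ 2) P := by
  have hc := hf.differentiable.continuous
  refine (h.integrable_iff (ψ := fun p => ‖(α * f p.2 / σ ^ 2) • (p.2 - p.1)‖ ^ 2)
    (by fun_prop)).2 ?_
  refine ((h.integrable_prod_sq hX hf hσ.le).const_mul ((α / σ) ^ 2)).congr
    (ae_of_all _ fun p => ?_)
  simp only [add_sub_cancel_left, norm_smul, mul_pow, Real.norm_eq_abs, sq_abs]
  field_simp

theorem integral_sq_displacement_le (h : GaussianStep f α σ P X Y X') (hX : MemLp X 2 P)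
    (hf : RegularCost n K l L m f) (hσ : 0 < σ) :
    ∫ ω, ‖(α * f (Y ω) / σ ^ 2) • (Y ω - X ω)‖ ^ 2 ∂P ≤ (α / σ) ^ 2 *
      (2 * m ^ 2 * n + 4 * l ^ 2 * n * ∫ ω, ‖X ω‖ ^ 2 ∂P + 12 * l ^ 2 * n ^ 2 * σ ^ 2) := by
  have := h.isProbabilityMeasure_map
  have hc := hf.differentiable.continuous
  have i1 := h.integrable_norm_sq hX
  have e1 : ∫ ω, ‖(α * f (Y ω) / σ ^ 2) • (Y ω - X ω)‖ ^ 2 ∂P =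
      (α / σ) ^ 2 * ∫ v, ∫ z, f (v + σ • z) ^ 2 * ‖z‖ ^ 2 ∂(stdGaussian _) ∂(P.map X) := by
    rw [h.integral_eq (ψ := fun p => ‖(α * f p.2 / σ ^ 2) • (p.2 - p.1)‖ ^ 2) (by fun_prop),
      ← integral_prod _ (h.integrable_prod_sq hX hf hσ.le), ← integral_const_mul]
    congr 1
    ext p
    simp only [add_sub_cancel_left, norm_smul, mul_pow, Real.norm_eq_abs, sq_abs]
    field_simp
  have e2 : ∫ ω, ‖X ω‖ ^ 2 ∂P = ∫ v, ‖v‖ ^ 2 ∂(P.map X) :=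
    (integral_map h.aemeasurable_fst (f := fun v => ‖v‖ ^ 2) (by fun_prop)).symm
  rw [e1, e2]
  gcongr
  have i2 : Integrable (fun v : EuclideanSpace ℝ (Fin n) => 2 * m ^ 2 * n + 4 * l ^ 2 * n * ‖v‖ ^ 2)
    (P.map X) := (integrable_const _).add (i1.const_mul _)
  have i3 : Integrable (fun v : EuclideanSpace ℝ (Fin n) =>
      2 * m ^ 2 * n + 4 * l ^ 2 * n * ‖v‖ ^ 2 + 12 * l ^ 2 * n ^ 2 * σ ^ 2) (P.map X) :=
    i2.add (integrable_const _)
  refine (integral_mono (h.integrable_prod_sq hX hf hσ.le).integral_prod_left i3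
    fun v => hf.integral_sq_mul_norm_sq_le hσ.le v).trans ?_
  rw [integral_add i2 (integrable_const _), integral_add (integrable_const _) (i1.const_mul _),
    integral_const_mul (4 * l ^ 2 * (n : ℝ))]
  simp

theorem memLp_displacement (h : GaussianStep f α σ P X Y X') (hX : MemLp X 2 P)
    (hf : RegularCost n K l L m f) (hσ : 0 < σ) :
    MemLp (fun ω => (α * f (Y ω) / σ ^ 2) • (Y ω - X ω)) 2 P :=
  (memLp_two_iff_integrable_sq_norm (h.aestronglyMeasurable_displacement hf)).2
    (h.integrable_sq_displacement hX hf hσ)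

theorem memLp_next (h : GaussianStep f α σ P X Y X') (hX : MemLp X 2 P)
    (hf : RegularCost n K l L m f) (hσ : 0 < σ) : MemLp X' 2 P :=
  (hX.sub (h.memLp_displacement hX hf hσ)).ae_eq (by
    filter_upwards [h.update] with ω hω
    simp [hω])

/-- One step decreases the mean square of `q (X)` up to the second moment of the displacement,
if the gradient estimator correlates with `q`. -/
theorem integral_norm_sq_next_le (h : GaussianStep f α σ P X Y X') (hX : MemLp X 2 P)
    (hf : RegularCost n K l L m f) (hσ : 0 < σ) (hα : 0 ≤ α)
    {q : EuclideanSpace ℝ (Fin n) → EuclideanSpace ℝ (Fin n)} (hq : Measurable q) {A : ℝ}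
    (hqA : ∀ v, ‖q v‖ ≤ ‖v‖ + A) {H : EuclideanSpace ℝ (Fin n) → ℝ} (hH : Integrable H (P.map X))
    (hle : ∀ v, H v ≤ ∫ z, f (v + σ • z) * inner ℝ z (q v) ∂(stdGaussian _)) :
    ∫ ω, ‖X' ω - X ω + q (X ω)‖ ^ 2 ∂P ≤ ∫ ω, ‖q (X ω)‖ ^ 2 ∂P
      - 2 * (α / σ) * ∫ v, H v ∂(P.map X) + (α / σ) ^ 2 *
      (2 * m ^ 2 * n + 4 * l ^ 2 * n * ∫ ω, ‖X ω‖ ^ 2 ∂P + 12 * l ^ 2 * n ^ 2 * σ ^ 2) := by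
  have := h.isProbabilityMeasure_map
  have hc := hf.differentiable.continuous
  have hA : 0 ≤ A := by simpa using (norm_nonneg _).trans (hqA 0)
  set W : Ω → EuclideanSpace ℝ (Fin n) := fun ω => (α * f (Y ω) / σ ^ 2) • (Y ω - X ω) with hW
  have hWm : MemLp W 2 P := h.memLp_displacement hX hf hσ
  have hqm : MemLp (fun ω => q (X ω)) 2 P :=
    (hX.norm.add (memLp_const A)).mono
      (hq.comp_aemeasurable h.aemeasurable_fst).aestronglyMeasurable
      (ae_of_all _ fun ω => by
        rw [Pi.add_apply, Real.norm_of_nonneg (by positivity)]; exact hqA _)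
  have i1 : Integrable (fun ω => ‖q (X ω)‖ ^ 2) P := hqm.integrable_norm_pow two_ne_zero
  have i3 : Integrable (fun ω => ‖W ω‖ ^ 2) P := hWm.integrable_norm_pow two_ne_zero
  have i2 : Integrable (fun ω => inner ℝ (W ω) (q (X ω))) P :=
    Integrable.mono' (i3.add i1) (hWm.1.inner hqm.1) (ae_of_all _ fun ω => by
      rw [Real.norm_eq_abs, Pi.add_apply]
      nlinarith [abs_real_inner_le_norm (W ω) (q (X ω)), sq_nonneg (‖W ω‖ - ‖q (X ω)‖),
        sq_nonneg ‖W ω‖, sq_nonneg ‖q (X ω)‖])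
  have hψ : Measurable fun p : EuclideanSpace ℝ (Fin n) × EuclideanSpace ℝ (Fin n) =>
    inner ℝ ((α * f p.2 / σ ^ 2) • (p.2 - p.1)) (q p.1) := by fun_prop
  have e2 : ∫ ω, inner ℝ (W ω) (q (X ω)) ∂P = ∫ v, (α / σ) *
      ∫ z, f (v + σ • z) * inner ℝ z (q v) ∂(stdGaussian _) ∂(P.map X) := by
    rw [hW, h.integral_eq hψ, integral_prod _ ((h.integrable_iff hψ).1 i2)]
    congr 1
    ext v
    rw [← integral_const_mul]
    congr 1
    ext z
    simp only [add_sub_cancel_left, inner_smul_left, conj_trivial]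
    field_simp
  have i4 : Integrable (fun v => (α / σ) *
      ∫ z, f (v + σ • z) * inner ℝ z (q v) ∂(stdGaussian _)) (P.map X) := by
    refine ((h.integrable_iff hψ).1 i2).integral_prod_left.congr (ae_of_all _ fun v => ?_)
    simp only
    rw [← integral_const_mul]
    congr 1
    ext z
    simp only [add_sub_cancel_left, inner_smul_left, conj_trivial]
    field_simp
  have hlow : (α / σ) * ∫ v, H v ∂(P.map X) ≤ ∫ ω, inner ℝ (W ω) (q (X ω)) ∂P := by
    rw [e2, ← integral_const_mul]
    refine integral_mono (hH.const_mul _) i4 fun v => ?_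
    exact mul_le_mul_of_nonneg_left (hle v) (by positivity)
  have e : ∫ ω, ‖X' ω - X ω + q (X ω)‖ ^ 2 ∂P =
      ∫ ω, ‖q (X ω)‖ ^ 2 ∂P - 2 * ∫ ω, inner ℝ (W ω) (q (X ω)) ∂P + ∫ ω, ‖W ω‖ ^ 2 ∂P := by
    have i5 : Integrable (fun ω => ‖q (X ω)‖ ^ 2 - 2 * inner ℝ (W ω) (q (X ω))) P :=
      i1.sub (i2.const_mul 2)
    rw [← integral_const_mul, ← integral_sub i1 (i2.const_mul 2), ← integral_add i5 i3]
    refine integral_congr_ae ?_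
    filter_upwards [h.update] with ω hω
    rw [hω, sub_sub_cancel_left, neg_add_eq_sub, norm_sub_sq_real, real_inner_comm]
  have := h.integral_sq_displacement_le hX hf hσ
  rw [e]
  linarith

/-- The regret of one query against `y`, in terms of the change of the distance to `y`. -/
theorem regret_le (h : GaussianStep f α σ P X Y X') (hX : MemLp X 2 P)
    (hf : RegularCost n K l L m f) (hσ : 0 < σ) (hα : 0 ≤ α) (y : EuclideanSpace ℝ (Fin n)) :
    ∫ ω, ‖X' ω - y‖ ^ 2 ∂P ≤ ∫ ω, ‖X ω - y‖ ^ 2 ∂P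
      - 2 * α * (∫ ω, f (Y ω) ∂P - f y - L * σ ^ 2 * n) + (α / σ) ^ 2 *
      (2 * m ^ 2 * n + 4 * l ^ 2 * n * ∫ ω, ‖X ω‖ ^ 2 ∂P + 12 * l ^ 2 * n ^ 2 * σ ^ 2) := by
  have := h.isProbabilityMeasure_map
  have i1 : Integrable (fun v => ∫ z, f (v + σ • z) ∂(stdGaussian _)) (P.map X) :=
    (h.integrable_prod_cost hX hf hσ.le).integral_prod_left
  have i2 : Integrable (fun v => ∫ z, f (v + σ • z) ∂(stdGaussian _) - f y) (P.map X) :=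
    i1.sub (integrable_const _)
  -- For this q the vector X' - X + q(X) is X' - y.
  have key := h.integral_norm_sq_next_le hX hf hσ hα (q := fun v => v - y) (by fun_prop)
    (A := ‖y‖) (fun v => norm_sub_le v y)
    (H := fun v => σ * (∫ z, f (v + σ • z) ∂(stdGaussian _) - f y - L * σ ^ 2 * n))
    ((i2.sub (integrable_const _)).const_mul σ)
    (fun v => hf.le_integral_comp_mul_inner hσ.le v y)
  rw [integral_const_mul, integral_sub i2 (integrable_const _), integral_sub i1 (integrable_const _),
    ← h.integral_cost hX hf hσ.le] at key
  simp only [integral_const, probReal_univ, one_smul, sub_add_sub_cancel] at key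
  refine key.trans (le_of_eq ?_)
  field_simp

end GaussianStep

/-! ### The part of an iterate outside a ball -/

/-- The fraction of `v` that lies outside the ball of radius `R`. -/
noncomputable def excess (R : ℝ) (v : EuclideanSpace ℝ (Fin n)) : ℝ := max 0 (1 - R / ‖v‖)

theorem excess_nonneg (R : ℝ) (v : EuclideanSpace ℝ (Fin n)) : 0 ≤ excess R v := le_max_left _ _

theorem excess_le_one {R : ℝ} (hR : 0 ≤ R) (v : EuclideanSpace ℝ (Fin n)) : excess R v ≤ 1 :=
  max_le zero_le_one (by have : 0 ≤ R / ‖v‖ := by positivity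
                         linarith)

theorem norm_excess_smul {R : ℝ} (hR : 0 ≤ R) (v : EuclideanSpace ℝ (Fin n)) :
    ‖excess R v • v‖ = max 0 (‖v‖ - R) := by
  rw [norm_smul, Real.norm_of_nonneg (excess_nonneg R v), excess]
  rcases eq_or_lt_of_le (norm_nonneg v) with h | h
  · rw [← h]; simp [hR]
  · rw [max_mul_of_nonneg _ _ h.le, zero_mul, sub_mul, one_mul, div_mul_cancel₀ _ h.ne']

theorem norm_sub_excess_smul_le {R : ℝ} (hR : 0 ≤ R) (v : EuclideanSpace ℝ (Fin n)) :
    ‖v - excess R v • v‖ ≤ R := by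
  have : v - excess R v • v = (1 - excess R v) • v := by rw [sub_smul, one_smul]
  rw [this, norm_smul, Real.norm_of_nonneg (by linarith [excess_le_one hR v])]
  have h := norm_excess_smul hR v
  rw [norm_smul, Real.norm_of_nonneg (excess_nonneg R v)] at h
  have := le_max_right 0 (‖v‖ - R)
  linarith

/-- The vector q(v) = `excess R v • v` is v minus its projection to the ball of radius R = 2√K. It
vanishes inside the ball and is parallel to v outside, so only the outward drift at radius at least
R enters. -/
theorem GaussianStep.excess_le {f : EuclideanSpace ℝ (Fin n) → ℝ} {α σ : ℝ} {Ω : Type u}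
    [MeasurableSpace Ω] {P : Measure Ω} [IsProbabilityMeasure P]
    {X Y X' : Ω → EuclideanSpace ℝ (Fin n)} {K l L m : ℝ}
    (h : GaussianStep f α σ P X Y X') (hX : MemLp X 2 P)
    (hf : RegularCost n K l L m f) (hn : 1 ≤ n) (hK : 0 < K) (hσ : 0 < σ) (hα : 0 ≤ α) (j : ℕ) :
    ∫ ω, ‖excess (2 * √K) (X' ω) • X' ω‖ ^ 2 ∂P ≤
      ∫ ω, ‖excess (2 * √K) (X ω) • X ω‖ ^ 2 ∂P
      + 2 * α * (L * σ ^ 2 * n + l * √K * (σ / √K) ^ j *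
        ∫ z : EuclideanSpace ℝ (Fin n), ‖z‖ ^ j ∂(stdGaussian _)) + (α / σ) ^ 2 *
      (2 * m ^ 2 * n + 4 * l ^ 2 * n * ∫ ω, ‖X ω‖ ^ 2 ∂P + 12 * l ^ 2 * n ^ 2 * σ ^ 2) := by
  have := h.isProbabilityMeasure_map
  have hR : 0 ≤ 2 * √K := by positivity
  have hm : Measurable (excess (n := n) (2 * √K)) := by unfold excess; fun_prop
  have hL := hf.L_nonneg hn
  have hl := hf.l_nonneg
  set ρ := L * σ ^ 2 * n + l * √K * (σ / √K) ^ j *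
        ∫ z : EuclideanSpace ℝ (Fin n), ‖z‖ ^ j ∂(stdGaussian _) with hρ
  have hρ0 : 0 ≤ ρ := by
    have : 0 ≤ ∫ z : EuclideanSpace ℝ (Fin n), ‖z‖ ^ j ∂(stdGaussian _) :=
      integral_nonneg fun z => by positivity
    positivity
  have hqm : Measurable fun v : EuclideanSpace ℝ (Fin n) => excess (2 * √K) v • v :=
    hm.smul measurable_id
  have hqle : ∀ v : EuclideanSpace ℝ (Fin n), ‖excess (2 * √K) v • v‖ ≤ ‖v‖ + 0 := fun v => by
    rw [norm_excess_smul hR]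
    exact max_le (by positivity) (by linarith)
  have key := h.integral_norm_sq_next_le hX hf hσ hα hqm hqle
    (H := fun _ => -(σ * ρ)) (integrable_const _) (fun v => ?_)
  · have hX' := h.memLp_next hX hf hσ
    -- The distance from X' to the ball is at most its distance to the projection of X, a point of
    -- the ball.
    have hmono : ∫ ω, ‖excess (2 * √K) (X' ω) • X' ω‖ ^ 2 ∂P ≤
        ∫ ω, ‖X' ω - X ω + excess (2 * √K) (X ω) • X ω‖ ^ 2 ∂P := by
      refine integral_mono_of_nonneg (ae_of_all _ fun ω => by positivity) ?_
        (ae_of_all _ fun ω => ?_)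
      · have hqX : MemLp (fun ω => excess (2 * √K) (X ω) • X ω) 2 P :=
          hX.mono (hqm.comp_aemeasurable h.aemeasurable_fst).aestronglyMeasurable
            (ae_of_all _ fun ω => by simpa using hqle (X ω))
        exact ((hX'.sub hX).add hqX).integrable_norm_pow two_ne_zero
      · simp only
        gcongr
        rw [norm_excess_smul hR]
        refine max_le (norm_nonneg _) ?_
        have h1 := norm_sub_excess_smul_le hR (X ω)
        have h2 := norm_sub_norm_le (X' ω) (X ω - excess (2 * √K) (X ω) • X ω)
        rw [← sub_add] at h2
        linarith
    refine (hmono.trans key).trans (le_of_eq ?_)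
    simp only [integral_const, probReal_univ, one_smul]
    field_simp
    ring
  · simp_rw [inner_smul_right, mul_left_comm _ (excess (2 * √K) v)]
    rw [integral_const_mul, hf.integral_comp_mul_inner hσ.le]
    by_cases hv : 2 * √K ≤ ‖v‖
    · have h1 := hf.le_integral_inner_gradient hK hσ.le hv j
      have h2 := excess_nonneg (2 * √K) v
      have h3 := excess_le_one hR v
      have h4 : excess (2 * √K) v * ρ ≤ ρ := by nlinarith
      have h5 := mul_le_mul_of_nonneg_left h1 (mul_nonneg h2 hσ.le)
      rw [← hρ] at h5
      nlinarith
    · have h1 : excess (2 * √K) v • v = 0 := by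
        rw [← norm_eq_zero, norm_excess_smul hR]
        exact max_eq_left (by linarith)
      rcases smul_eq_zero.1 h1 with h2 | h2
      · rw [h2]; nlinarith
      · rw [h2]; simp; positivity

theorem norm_sq_le_excess {R : ℝ} (hR : 0 ≤ R) (v : EuclideanSpace ℝ (Fin n)) :
    ‖v‖ ^ 2 ≤ 2 * R ^ 2 + 2 * ‖excess R v • v‖ ^ 2 := by
  rw [norm_excess_smul hR]
  have h1 : ‖v‖ ≤ R + max 0 (‖v‖ - R) := by linarith [le_max_right 0 (‖v‖ - R)]
  calc _ ≤ (R + max 0 (‖v‖ - R)) ^ 2 := by gcongr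
    _ ≤ _ := by nlinarith [sq_nonneg (R - max 0 (‖v‖ - R))]

/-! ### Sums of powers, summation by parts, discrete Grönwall -/

/-- Bernoulli's inequality (1 - 1/s)^{1-q} ≤ 1 - (1-q)/s shows that s^{1-q}/(1-q) grows by at least
s^{-q} from s - 1 to s. -/
theorem sum_one_div_rpow_le {q : ℝ} (h0 : 0 ≤ q) (h1 : q < 1) (T : ℕ) :
    ∑ t ∈ Finset.Icc 1 T, 1 / (t : ℝ) ^ q ≤ (T : ℝ) ^ (1 - q) / (1 - q) := by
  have hq : 0 < 1 - q := by linarith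
  induction T with
  | zero => simp [Real.zero_rpow hq.ne']
  | succ T ih =>
    rw [Finset.sum_Icc_succ_top (by omega)]
    refine (add_le_add_left ih _).trans ?_
    set s : ℝ := ((T + 1 : ℕ) : ℝ) with hs
    have hs0 : 0 < s := by positivity
    have hT : (T : ℝ) = s * (1 + -(1 / s)) := by rw [hs]; push_cast; field_simp; ring
    have hs1 : -1 ≤ -(1 / s) := by
      rw [neg_le_neg_iff, div_le_one hs0, hs]
      exact_mod_cast Nat.succ_le_succ (Nat.zero_le T)
    have hb := rpow_one_add_le_one_add_mul_self hs1 hq.le (by linarith : 1 - q ≤ 1)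
    have hle : (T : ℝ) ^ (1 - q) ≤ s ^ (1 - q) * (1 + (1 - q) * -(1 / s)) := by
      rw [hT, Real.mul_rpow hs0.le (by linarith)]
      gcongr
    have hsq : s ^ (1 - q) * (1 / s) = 1 / s ^ q := by
      rw [Real.rpow_sub hs0, Real.rpow_one]
      field_simp
    rw [← sub_nonneg]
    have : s ^ (1 - q) / (1 - q) - ((T : ℝ) ^ (1 - q) / (1 - q) + 1 / s ^ q) =
        (s ^ (1 - q) * (1 + (1 - q) * -(1 / s)) - (T : ℝ) ^ (1 - q)) / (1 - q) := by
      rw [← hsq]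
      field_simp
      ring
    rw [this]
    exact div_nonneg (by linarith) hq.le

theorem one_div_mul_rpow (n t : ℕ) (q : ℝ) :
    1 / ((n : ℝ) * t) ^ q = 1 / (n : ℝ) ^ q * (1 / (t : ℝ) ^ q) := by
  rw [Real.mul_rpow (by positivity) (by positivity), one_div_mul_one_div]

theorem sum_one_div_mul_rpow_le (n : ℕ) {q : ℝ} (h0 : 0 ≤ q) (h1 : q < 1) (T : ℕ) :
    ∑ t ∈ Finset.Icc 1 T, 1 / ((n : ℝ) * t) ^ q ≤
      1 / (n : ℝ) ^ q * ((T : ℝ) ^ (1 - q) / (1 - q)) := by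
  simp_rw [one_div_mul_rpow]
  rw [← Finset.mul_sum]
  gcongr
  exact sum_one_div_rpow_le h0 h1 T

/-- Summation by parts for a bounded sequence with monotone weights. -/
theorem sum_sub_mul_le {D β : ℕ → ℝ} {B : ℝ} {T : ℕ} (hD : ∀ t, 0 ≤ D t)
    (hB : ∀ t, 1 ≤ t → t ≤ T → D t ≤ B) (hβ : ∀ t, 0 ≤ β t) (hmono : Monotone β) (hT : 1 ≤ T) :
    ∑ t ∈ Finset.Icc 1 T, (D t - D (t + 1)) * β t ≤ B * β T := by
  -- The induction needs the boundary term, which is dropped at the end.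
  suffices h : ∀ S, 1 ≤ S → S ≤ T →
      ∑ t ∈ Finset.Icc 1 S, (D t - D (t + 1)) * β t ≤ B * β S - D (S + 1) * β S by
    have h1 := h T hT le_rfl
    have h2 := mul_nonneg (hD (T + 1)) (hβ T)
    linarith
  intro S hS
  induction S, hS using Nat.le_induction with
  | base =>
    intro h1
    have := mul_le_mul_of_nonneg_right (hB 1 le_rfl h1) (hβ 1)
    simp
    linarith
  | succ S hS ih =>
    intro h1
    rw [Finset.sum_Icc_succ_top (by omega)]
    have h2 := ih (by omega)
    have h3 := hB (S + 1) (by omega) h1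
    have h4 : β S ≤ β (S + 1) := hmono (by omega)
    nlinarith [mul_le_mul_of_nonneg_right h3 (sub_nonneg.2 h4)]

/-- A discrete Grönwall inequality, with a factor on the non-summable part of the forcing that does
not depend on the data. -/
theorem exists_bound_of_recursion {ε δ g : ℕ → ℝ} (hε : ∀ t, 0 ≤ ε t) (hδ : ∀ t, 0 ≤ δ t)
    (hg : ∀ t, 0 ≤ g t) (hsε : Summable ε) (hsδ : Summable δ) {e₁ : ℝ} (he₁ : 0 ≤ e₁) :
    ∃ D, 0 ≤ D ∧ ∀ e : ℕ → ℝ, (∀ t, 0 ≤ e t) → e 1 ≤ e₁ →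
      (∀ t, 1 ≤ t → e (t + 1) ≤ (1 + ε t) * e t + δ t + g t) →
      ∀ t, 1 ≤ t → e t ≤ D + 2 * ∑ s ∈ Finset.Icc 1 t, g s := by
  -- The recursion solved with equality; E k dominates e (k + 1), for every e at once.
  let E : ℕ → ℝ := fun k =>
    Nat.rec e₁ (fun k x => (1 + ε (k + 1)) * x + δ (k + 1) + g (k + 1)) k
  have hE : ∀ k, E (k + 1) = (1 + ε (k + 1)) * E k + δ (k + 1) + g (k + 1) := fun k => rfl
  have hE0 : ∀ k, 0 ≤ E k := by
    intro k
    induction k with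
    | zero => exact he₁
    | succ k ih =>
      rw [hE]
      have := hε (k + 1); have := hδ (k + 1); have := hg (k + 1)
      positivity
  have hEmono : Monotone E := by
    refine monotone_nat_of_le_succ fun k => ?_
    rw [hE]
    have := mul_nonneg (hε (k + 1)) (hE0 k); have := hδ (k + 1); have := hg (k + 1)
    linarith
  -- Beyond N the tail of ε sums to at most log 2, so later growth is by a factor of at most 2
  -- however large ε is. Earlier growth goes into D through E N.
  obtain ⟨N, hN⟩ := ((tendsto_sum_nat_add ε).eventually
    (eventually_le_nhds (Real.log_pos one_lt_two))).exists
  have hfac : ∀ j, Real.exp (∑ i ∈ Finset.range j, ε (i + (N + 1))) ≤ 2 := by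
    intro j
    rw [← Real.le_log_iff_exp_le two_pos]
    have h1 : Summable fun i => ε (i + (N + 1)) := (summable_nat_add_iff (N + 1)).2 hsε
    have h2 : Summable fun i => ε (i + N) := (summable_nat_add_iff N).2 hsε
    refine (h1.sum_le_tsum _ fun i _ => hε _).trans (le_trans ?_ hN)
    rw [h2.tsum_eq_zero_add]
    simp_rw [add_right_comm _ 1 N, ← add_assoc]
    linarith [hε (0 + N)]
  have hbound : ∀ j, E (N + j) ≤ Real.exp (∑ i ∈ Finset.range j, ε (i + (N + 1))) *
      (E N + ∑ i ∈ Finset.range j, (δ (i + (N + 1)) + g (i + (N + 1)))) := by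
    intro j
    induction j with
    | zero => simp
    | succ j ih =>
      rw [← add_assoc, hE, Finset.sum_range_succ, Finset.sum_range_succ, Real.exp_add,
        show N + j + 1 = j + (N + 1) by ring]
      set x := j + (N + 1)
      set p := Real.exp (∑ i ∈ Finset.range j, ε (i + (N + 1)))
      set s := ∑ i ∈ Finset.range j, (δ (i + (N + 1)) + g (i + (N + 1)))
      have hp : 1 ≤ p := Real.one_le_exp (Finset.sum_nonneg fun i _ => hε _)
      have hx : 1 + ε x ≤ Real.exp (ε x) := by linarith [Real.add_one_le_exp (ε x)]
      have hx1 : 1 ≤ Real.exp (ε x) := Real.one_le_exp (hε x)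
      have hx0 := hε x
      have hd : 0 ≤ δ x + g x := add_nonneg (hδ x) (hg x)
      have h1 : (1 + ε x) * E (N + j) ≤ Real.exp (ε x) * (p * (E N + s)) :=
        mul_le_mul hx ih (hE0 _) (by positivity)
      have h2 : δ x + g x ≤ p * Real.exp (ε x) * (δ x + g x) :=
        le_mul_of_one_le_left hd (one_le_mul_of_one_le_of_one_le hp hx1)
      linarith
  have hδ0 : 0 ≤ ∑' t, δ t := tsum_nonneg hδ
  refine ⟨2 * (E N + ∑' t, δ t), ?_, fun e he h1 hrec t ht => ?_⟩
  · have := hE0 N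
    positivity
  have heE : ∀ k, e (k + 1) ≤ E k := by
    intro k
    induction k with
    | zero => exact h1
    | succ k ih =>
      rw [hE]
      refine (hrec (k + 1) (by omega)).trans ?_
      have := hε (k + 1)
      gcongr
  obtain ⟨k, rfl⟩ : ∃ k, t = k + 1 := ⟨t - 1, by omega⟩
  have hkE : E k ≤ E (N + k) := hEmono (by omega)
  have hδN : ∀ j, ∑ i ∈ Finset.range j, δ (i + (N + 1)) ≤ ∑' t, δ t := by
    intro j
    have h1 : Summable fun i => δ (i + (N + 1)) := (summable_nat_add_iff (N + 1)).2 hsδ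
    refine (h1.sum_le_tsum _ fun i _ => hδ _).trans ?_
    rw [← hsδ.sum_add_tsum_nat_add (N + 1)]
    have : 0 ≤ ∑ i ∈ Finset.range (N + 1), δ i := Finset.sum_nonneg fun i _ => hδ _
    linarith
  have hg0 : 0 ≤ ∑ s ∈ Finset.Icc 1 (k + 1), g s := Finset.sum_nonneg fun i _ => hg _
  rcases le_total k N with hkN | hkN
  · have := heE k
    have := hEmono hkN
    have := hE0 N
    linarith
  · obtain ⟨j, rfl⟩ := Nat.exists_eq_add_of_le hkN
    have h2 := hbound j
    have hgj : ∑ i ∈ Finset.range j, g (i + (N + 1)) ≤ ∑ s ∈ Finset.Icc 1 (N + j + 1), g s := by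
      refine (Finset.sum_map (Finset.range j) (addRightEmbedding (N + 1)) g).ge.trans ?_
      refine Finset.sum_le_sum_of_subset_of_nonneg (fun i hi => ?_) fun i _ _ => hg i
      simp only [Finset.mem_map, Finset.mem_range, addRightEmbedding_apply] at hi
      obtain ⟨x, hx, rfl⟩ := hi
      simp only [Finset.mem_Icc]
      omega
    have hnn : 0 ≤ E N + ∑ i ∈ Finset.range j, (δ (i + (N + 1)) + g (i + (N + 1))) :=
      add_nonneg (hE0 N) (Finset.sum_nonneg fun i _ => add_nonneg (hδ _) (hg _))
    have h3 := mul_le_mul_of_nonneg_right (hfac j) hnn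
    rw [Finset.sum_add_distrib] at h2 h3
    have := heE (N + j)
    have := hδN j
    linarith

/-! ### Powers of n and t, and the accumulated bias -/

theorem rpow_div_rpow_le {n T : ℕ} (hn : 1 ≤ n) (hT : 1 ≤ T) {p p' q q' : ℝ} (hp : p ≤ p')
    (hq : q' ≤ q) : (n : ℝ) ^ p / (T : ℝ) ^ q ≤ (n : ℝ) ^ p' / (T : ℝ) ^ q' := by
  have hn' : (1 : ℝ) ≤ n := by exact_mod_cast hn
  have hT' : (1 : ℝ) ≤ T := by exact_mod_cast hT
  gcongr

namespace AdmissibleExponents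

variable {a b : ℝ}

theorem two_b_lt (h : AdmissibleExponents a b) : 2 * b < a := by
  have := h.a_lt_one; have := h.gap; linarith

end AdmissibleExponents

theorem stepSize_pos (a : ℝ) {n t : ℕ} (hn : 1 ≤ n) (ht : 1 ≤ t) : 0 < stepSize a n t := by
  have : (0 : ℝ) < n := by exact_mod_cast hn
  have : (0 : ℝ) < t := by exact_mod_cast ht
  unfold stepSize
  positivity

theorem querySd_pos (b : ℝ) {n t : ℕ} (hn : 1 ≤ n) (ht : 1 ≤ t) : 0 < querySd b n t :=
  stepSize_pos b hn ht

theorem querySd_pow (b : ℝ) (n t k : ℕ) :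
    querySd b n t ^ k = 1 / ((n : ℝ) * t) ^ (b * k) := by
  unfold querySd
  rw [div_pow, one_pow, Real.rpow_mul (by positivity), Real.rpow_natCast]

theorem one_div_rpow_mul {n t : ℕ} (hn : 1 ≤ n) (ht : 1 ≤ t) (p q : ℝ) :
    1 / ((n : ℝ) * t) ^ p * (1 / ((n : ℝ) * t) ^ q) = 1 / ((n : ℝ) * t) ^ (p + q) := by
  have : (0 : ℝ) < n := by exact_mod_cast hn
  have : (0 : ℝ) < t := by exact_mod_cast ht
  rw [Real.rpow_add (by positivity), one_div_mul_one_div]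

theorem one_div_rpow_div {n t : ℕ} (hn : 1 ≤ n) (ht : 1 ≤ t) (p q : ℝ) :
    1 / ((n : ℝ) * t) ^ p / (1 / ((n : ℝ) * t) ^ q) = 1 / ((n : ℝ) * t) ^ (p - q) := by
  have : (0 : ℝ) < n := by exact_mod_cast hn
  have : (0 : ℝ) < t := by exact_mod_cast ht
  rw [Real.rpow_sub (by positivity)]
  field_simp

theorem one_div_rpow_le_one_div_rpow {n t : ℕ} (hn : 1 ≤ n) (ht : 1 ≤ t) {p q : ℝ} (hq : 0 ≤ q)
    (hqp : q ≤ p) : 1 / ((n : ℝ) * t) ^ p ≤ 1 / (t : ℝ) ^ q := by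
  have hn' : (1 : ℝ) ≤ n := by exact_mod_cast hn
  have ht' : (1 : ℝ) ≤ t := by exact_mod_cast ht
  have h1 : (t : ℝ) ≤ n * t := le_mul_of_one_le_left (by positivity) hn'
  have h2 : (t : ℝ) ^ q ≤ ((n : ℝ) * t) ^ p :=
    (Real.rpow_le_rpow (by positivity) h1 hq).trans
      (Real.rpow_le_rpow_of_exponent_le (ht'.trans h1) hqp)
  exact one_div_le_one_div_of_le (by positivity) h2

/-- The accumulated smoothing bias `∑_{t ≤ T} α_t σ_t²`. -/
noncomputable def biasSum (a b : ℝ) (n T : ℕ) : ℝ :=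
  ∑ t ∈ Finset.Icc 1 T, 1 / ((n : ℝ) * t) ^ (a + 2 * b)

theorem biasSum_nonneg (a b : ℝ) (n T : ℕ) : 0 ≤ biasSum a b n T :=
  Finset.sum_nonneg fun t _ => by positivity

theorem biasSum_mono (a b : ℝ) (n : ℕ) : Monotone (biasSum a b n) := fun S T h =>
  Finset.sum_le_sum_of_subset_of_nonneg (Finset.Icc_subset_Icc le_rfl h) fun t _ _ => by positivity

/-- The exponent is lowered to e < 1 in t only, the power of n staying exact. This covers a+2b ≥ 1
and keeps 1/(1-e) under control for a+2b near 1. -/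
theorem biasSum_le {a b : ℝ} (n : ℕ) {e : ℝ} (he0 : 0 ≤ e) (he1 : e < 1) (hab : e ≤ a + 2 * b)
    (T : ℕ) : biasSum a b n T ≤ 1 / (n : ℝ) ^ (a + 2 * b) * ((T : ℝ) ^ (1 - e) / (1 - e)) := by
  unfold biasSum
  simp_rw [one_div_mul_rpow]
  rw [← Finset.mul_sum]
  gcongr
  refine le_trans (Finset.sum_le_sum fun t ht => ?_) (sum_one_div_rpow_le he0 he1 T)
  have ht' : (1 : ℝ) ≤ t := by exact_mod_cast (Finset.mem_Icc.1 ht).1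
  gcongr

theorem biasSum_le_tsum {a b : ℝ} {n : ℕ} (hn : 1 ≤ n) (hab : 1 < a + 2 * b) (T : ℕ) :
    biasSum a b n T ≤ ∑' t : ℕ, 1 / (t : ℝ) ^ (a + 2 * b) := by
  refine le_trans (Finset.sum_le_sum fun t ht => ?_)
    ((Real.summable_one_div_nat_rpow.2 hab).sum_le_tsum (Finset.Icc 1 T) fun t _ => by positivity)
  exact one_div_rpow_le_one_div_rpow hn (Finset.mem_Icc.1 ht).1 (by linarith) le_rfl

/-! ### Regret from a bound on second moments -/

namespace OnePointRun

variable {a b : ℝ} {c : ℕ → EuclideanSpace ℝ (Fin n) → ℝ} {μ₁ : EuclideanSpace ℝ (Fin n)}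
  {Ω : Type u} [MeasurableSpace Ω] {P : Measure Ω} [IsProbabilityMeasure P]
  {μ x : ℕ → Ω → EuclideanSpace ℝ (Fin n)} {K l L m : ℝ}

theorem memLp (h : OnePointRun a b c μ₁ P μ x) (hc : CostClass n K l L m c) (hn : 1 ≤ n) :
    ∀ t, 1 ≤ t → MemLp (μ t) 2 P := by
  intro t ht
  induction t, ht using Nat.le_induction with
  | base =>
    refine (memLp_const μ₁).ae_eq ?_
    filter_upwards [h.init] with ω hω using hω.symm
  | succ t ht ih =>
    exact (h.gaussianStep ht).memLp_next ih (hc.regularCost ht) (querySd_pos b hn ht)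

theorem integrable_cost (h : OnePointRun a b c μ₁ P μ x) (hc : CostClass n K l L m c)
    (hn : 1 ≤ n) {t : ℕ} (ht : 1 ≤ t) : Integrable (fun ω => c t (x t ω)) P :=
  (h.gaussianStep ht).integrable_cost (h.memLp hc hn t ht) (hc.regularCost ht)
    (querySd_pos b hn ht).le

theorem integrable_sum_cost (h : OnePointRun a b c μ₁ P μ x) (hc : CostClass n K l L m c)
    (hn : 1 ≤ n) (T : ℕ) : Integrable (fun ω => ∑ t ∈ Finset.Icc 1 T, c t (x t ω)) P :=
  integrable_finsetSum _ fun _ ht => h.integrable_cost hc hn (Finset.mem_Icc.1 ht).1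

theorem integrable_regret (h : OnePointRun a b c μ₁ P μ x) (hc : CostClass n K l L m c)
    (hn : 1 ≤ n) (y : EuclideanSpace ℝ (Fin n)) (T : ℕ) : Integrable (regret c x y T) P :=
  (h.integrable_sum_cost hc hn T).sub (integrable_const _)

theorem expAvgRegret_eq (h : OnePointRun a b c μ₁ P μ x) (hc : CostClass n K l L m c)
    (hn : 1 ≤ n) (y : EuclideanSpace ℝ (Fin n)) (T : ℕ) :
    expAvgRegret c P x y T =
      (∑ t ∈ Finset.Icc 1 T, (∫ ω, c t (x t ω) ∂P - c t y)) / T := by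
  unfold expAvgRegret
  rw [integral_div]
  congr 1
  unfold regret
  rw [integral_sub (h.integrable_sum_cost hc hn T) (integrable_const _), integral_finsetSum _
    fun _ ht => h.integrable_cost hc hn (Finset.mem_Icc.1 ht).1, Finset.sum_sub_distrib]
  simp

/-- The one-step inequality divided by 2α_t. -/
theorem cost_sub_le (h : OnePointRun a b c μ₁ P μ x) (hc : CostClass n K l L m c)
    (hn : 1 ≤ n) (y : EuclideanSpace ℝ (Fin n)) {t : ℕ} (ht : 1 ≤ t) {B : ℝ}
    (hB : ∫ ω, ‖μ t ω‖ ^ 2 ∂P ≤ B) :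
    ∫ ω, c t (x t ω) ∂P - c t y ≤
      (∫ ω, ‖μ t ω - y‖ ^ 2 ∂P - ∫ ω, ‖μ (t + 1) ω - y‖ ^ 2 ∂P) * (((n : ℝ) * t) ^ a / 2) +
      (L * n * (1 / ((n : ℝ) * t) ^ (2 * b)) +
      (m ^ 2 + 2 * l ^ 2 * B) * n * (1 / ((n : ℝ) * t) ^ (a - 2 * b)) +
      6 * l ^ 2 * n ^ 2 * (1 / ((n : ℝ) * t) ^ a)) := by
  have hα := stepSize_pos a hn ht
  have hσ := querySd_pos b hn ht
  have key := (h.gaussianStep ht).regret_le (h.memLp hc hn t ht) (hc.regularCost ht) hσ hα.le y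
  have hB' : 4 * l ^ 2 * (n : ℝ) * ∫ ω, ‖μ t ω‖ ^ 2 ∂P ≤ 4 * l ^ 2 * n * B := by gcongr
  have hA : ((n : ℝ) * t) ^ a = 1 / stepSize a n t := by unfold stepSize; rw [one_div_one_div]
  have e1 : 1 / ((n : ℝ) * t) ^ a = stepSize a n t := rfl
  have e2 : 1 / ((n : ℝ) * t) ^ (2 * b) = querySd b n t ^ 2 := by
    rw [querySd_pow]; congr 2; push_cast; ring
  have e3 : 1 / ((n : ℝ) * t) ^ (a - 2 * b) = stepSize a n t / querySd b n t ^ 2 := by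
    rw [← e2, ← e1, one_div_rpow_div hn ht]
  rw [e1, hA, e2, e3]
  set α := stepSize a n t
  set σ := querySd b n t
  set D := ∫ ω, ‖μ t ω - y‖ ^ 2 ∂P
  set D' := ∫ ω, ‖μ (t + 1) ω - y‖ ^ 2 ∂P
  set r := ∫ ω, c t (x t ω) ∂P - c t y
  have h1 : (α / σ) ^ 2 * (2 * m ^ 2 * n + 4 * l ^ 2 * n * ∫ ω, ‖μ t ω‖ ^ 2 ∂P +
      12 * l ^ 2 * n ^ 2 * σ ^ 2) ≤ (α / σ) ^ 2 * (2 * m ^ 2 * n + 4 * l ^ 2 * n * B +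
      12 * l ^ 2 * n ^ 2 * σ ^ 2) := by gcongr
  have h2 : 2 * α * r ≤ 2 * α * ((D - D') * (1 / α / 2) + (L * n * σ ^ 2 +
      (m ^ 2 + 2 * l ^ 2 * B) * n * (α / σ ^ 2) + 6 * l ^ 2 * n ^ 2 * α)) := by
    have e : 2 * α * ((D - D') * (1 / α / 2) + (L * n * σ ^ 2 +
      (m ^ 2 + 2 * l ^ 2 * B) * n * (α / σ ^ 2) + 6 * l ^ 2 * n ^ 2 * α)) =
      D - D' + 2 * α * (L * σ ^ 2 * n) + (α / σ) ^ 2 * (2 * m ^ 2 * n + 4 * l ^ 2 * n * B +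
      12 * l ^ 2 * n ^ 2 * σ ^ 2) := by
      field_simp
      ring
    rw [e]
    linarith
  exact le_of_mul_le_mul_left h2 (by positivity)

/-- The average regret in terms of a bound on the second moments of the iterates. -/
theorem expAvgRegret_le (hab : AdmissibleExponents a b) (h : OnePointRun a b c μ₁ P μ x)
    (hc : CostClass n K l L m c) (hn : 1 ≤ n) {T : ℕ} (hT : 1 ≤ T) {B : ℝ}
    (hB : ∀ t, 1 ≤ t → t ≤ T → ∫ ω, ‖μ t ω‖ ^ 2 ∂P ≤ B) (y : EuclideanSpace ℝ (Fin n)) :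
    expAvgRegret c P x y T ≤
      (B + ‖y‖ ^ 2) * (6 / (1 - a) * ((n : ℝ) ^ a / (T : ℝ) ^ (1 - a))) +
      (m ^ 2 + l ^ 2 * (B + (n : ℝ) ^ (1 - 2 * b) / (T : ℝ) ^ (2 * b))) *
        (6 / (1 - a) * ((n : ℝ) ^ (1 - a + 2 * b) / (T : ℝ) ^ (a - 2 * b))) +
      L * (6 / (1 - a) * ((n : ℝ) ^ (1 - 2 * b) / (T : ℝ) ^ (2 * b))) := by
  have hn0 : (0 : ℝ) < n := by exact_mod_cast hn
  have hT0 : (0 : ℝ) < T := by exact_mod_cast hT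
  have ha1 : 0 < 1 - a := by linarith [hab.a_lt_one]
  have hL := (hc.regularCost le_rfl).L_nonneg hn
  have hB0 : 0 ≤ B := (integral_nonneg fun ω => by positivity).trans (hB 1 le_rfl hT)
  have hD : ∀ t, 1 ≤ t → t ≤ T → ∫ ω, ‖μ t ω - y‖ ^ 2 ∂P ≤ 2 * B + 2 * ‖y‖ ^ 2 := by
    intro t ht htT
    have i1 : Integrable (fun ω => 2 * ‖μ t ω‖ ^ 2 + 2 * ‖y‖ ^ 2) P :=
      (((h.memLp hc hn t ht).integrable_norm_pow two_ne_zero).const_mul 2).add (integrable_const _)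
    calc _ ≤ ∫ ω, (2 * ‖μ t ω‖ ^ 2 + 2 * ‖y‖ ^ 2) ∂P := by
          refine integral_mono_of_nonneg (ae_of_all _ fun ω => by positivity) i1
            (ae_of_all _ fun ω => ?_)
          have := norm_sub_le (μ t ω) y
          have h1 : ‖μ t ω - y‖ ^ 2 ≤ (‖μ t ω‖ + ‖y‖) ^ 2 := by gcongr
          have h2 : (‖μ t ω‖ + ‖y‖) ^ 2 ≤ 2 * ‖μ t ω‖ ^ 2 + 2 * ‖y‖ ^ 2 := by
            nlinarith [sq_nonneg (‖μ t ω‖ - ‖y‖)]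
          exact h1.trans h2
      _ = 2 * ∫ ω, ‖μ t ω‖ ^ 2 ∂P + 2 * ‖y‖ ^ 2 := by
          rw [integral_add (((h.memLp hc hn t ht).integrable_norm_pow two_ne_zero).const_mul 2)
            (integrable_const _), integral_const_mul]
          simp
      _ ≤ _ := by linarith [hB t ht htT]
  have hmono : Monotone fun t : ℕ => ((n : ℝ) * t) ^ a / 2 := fun s t hst => by
    have : (s : ℝ) ≤ t := by exact_mod_cast hst
    have := hab.a_pos
    simp only
    gcongr
  have habel := sum_sub_mul_le (D := fun t => ∫ ω, ‖μ t ω - y‖ ^ 2 ∂P)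
    (fun t => integral_nonneg fun ω => by positivity) hD (fun t => by positivity) hmono hT
  -- As q ≤ a, the denominator 1 - a serves all three sums.
  have hsum : ∀ q, 0 ≤ q → q ≤ a → ∑ t ∈ Finset.Icc 1 T, 1 / ((n : ℝ) * t) ^ q ≤
      1 / (n : ℝ) ^ q * ((T : ℝ) ^ (1 - q) / (1 - a)) := fun q hq hqa => by
    refine (sum_one_div_mul_rpow_le n hq (by linarith) T).trans ?_
    gcongr
  have hb := hab.b_pos
  have s1 := hsum (2 * b) (by linarith) hab.two_b_lt.le
  have s2 := hsum (a - 2 * b) (by linarith [hab.two_b_lt]) (by linarith)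
  have s3 := hsum a hab.a_pos.le le_rfl
  have hn1 : ∀ q : ℝ, (n : ℝ) * (1 / (n : ℝ) ^ q) = (n : ℝ) ^ (1 - q) := fun q => by
    rw [Real.rpow_sub hn0, Real.rpow_one, mul_one_div]
  have hT1 : ∀ q : ℝ, (T : ℝ) ^ (1 - q) / T = 1 / (T : ℝ) ^ q := fun q => by
    rw [Real.rpow_sub hT0, Real.rpow_one]; field_simp
  rw [h.expAvgRegret_eq hc hn]
  set X1 := (n : ℝ) ^ a / (T : ℝ) ^ (1 - a) with hX1
  set X2 := (n : ℝ) ^ (1 - a + 2 * b) / (T : ℝ) ^ (a - 2 * b) with hX2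
  set X3 := (n : ℝ) ^ (1 - 2 * b) / (T : ℝ) ^ (2 * b) with hX3
  have p1 : ((n : ℝ) * T) ^ a / T = X1 := by
    rw [hX1, Real.mul_rpow hn0.le hT0.le, Real.rpow_sub hT0, Real.rpow_one]
    field_simp
  have p3 : n * (1 / (n : ℝ) ^ (2 * b) * ((T : ℝ) ^ (1 - 2 * b) / (1 - a))) / T =
      X3 / (1 - a) := by
    rw [hX3, ← hn1]
    linear_combination (n * (1 / (n : ℝ) ^ (2 * b)) / (1 - a)) * hT1 (2 * b)
  have p2 : n * (1 / (n : ℝ) ^ (a - 2 * b) * ((T : ℝ) ^ (1 - (a - 2 * b)) / (1 - a))) / T =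
      X2 / (1 - a) := by
    rw [hX2, show 1 - a + 2 * b = 1 - (a - 2 * b) by ring, ← hn1]
    linear_combination (n * (1 / (n : ℝ) ^ (a - 2 * b)) / (1 - a)) * hT1 (a - 2 * b)
  -- The fourth-moment term n²α_t averages to the product of the second and third rates, hence the
  -- summand n^{1-2b}/T^{2b} beside B.
  have p4 : (n : ℝ) ^ 2 * (1 / (n : ℝ) ^ a * ((T : ℝ) ^ (1 - a) / (1 - a))) / T =
      X2 * X3 / (1 - a) := by
    have e1 : X2 * X3 = (n * (1 / (n : ℝ) ^ a)) * n * (1 / (T : ℝ) ^ a) := by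
      rw [hX2, hX3, div_mul_div_comm, ← Real.rpow_add hn0, ← Real.rpow_add hT0, hn1,
        show 1 - a + 2 * b + (1 - 2 * b) = 1 - a + 1 by ring, Real.rpow_add hn0, Real.rpow_one,
        sub_add_cancel]
      ring
    rw [e1]
    linear_combination (n * n * (1 / (n : ℝ) ^ a) / (1 - a)) * hT1 a
  have hX1p : 0 ≤ X1 := by positivity
  have hX2p : 0 ≤ X2 := by positivity
  have hX3p : 0 ≤ X3 := by positivity
  have htot : ∑ t ∈ Finset.Icc 1 T, (∫ ω, c t (x t ω) ∂P - c t y) ≤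
      (2 * B + 2 * ‖y‖ ^ 2) * (((n : ℝ) * T) ^ a / 2) +
      (L * n * (1 / (n : ℝ) ^ (2 * b) * ((T : ℝ) ^ (1 - 2 * b) / (1 - a))) +
      (m ^ 2 + 2 * l ^ 2 * B) * n *
        (1 / (n : ℝ) ^ (a - 2 * b) * ((T : ℝ) ^ (1 - (a - 2 * b)) / (1 - a))) +
      6 * l ^ 2 * n ^ 2 * (1 / (n : ℝ) ^ a * ((T : ℝ) ^ (1 - a) / (1 - a)))) := by
    refine (Finset.sum_le_sum fun t ht => h.cost_sub_le hc hn y (Finset.mem_Icc.1 ht).1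
      (hB t (Finset.mem_Icc.1 ht).1 (Finset.mem_Icc.1 ht).2)).trans ?_
    rw [Finset.sum_add_distrib, Finset.sum_add_distrib, Finset.sum_add_distrib, ← Finset.mul_sum,
      ← Finset.mul_sum, ← Finset.mul_sum]
    gcongr
  have hdiv := div_le_div_of_nonneg_right htot hT0.le
  refine hdiv.trans ?_
  have e : ((2 * B + 2 * ‖y‖ ^ 2) * (((n : ℝ) * T) ^ a / 2) +
      (L * n * (1 / (n : ℝ) ^ (2 * b) * ((T : ℝ) ^ (1 - 2 * b) / (1 - a))) +
      (m ^ 2 + 2 * l ^ 2 * B) * n *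
        (1 / (n : ℝ) ^ (a - 2 * b) * ((T : ℝ) ^ (1 - (a - 2 * b)) / (1 - a))) +
      6 * l ^ 2 * n ^ 2 * (1 / (n : ℝ) ^ a * ((T : ℝ) ^ (1 - a) / (1 - a))))) / T =
      (B + ‖y‖ ^ 2) * X1 + L * (X3 / (1 - a)) + (m ^ 2 + 2 * l ^ 2 * B) * (X2 / (1 - a)) +
      6 * l ^ 2 * (X2 * X3 / (1 - a)) := by
    rw [← p1, ← p2, ← p3, ← p4]
    ring
  rw [e]
  -- The 6 is the coefficient of l²n²α_t: half of 4·3, with 3n² bounding the Gaussian fourth moment.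
  have hk : 1 ≤ 6 / (1 - a) := by rw [le_div_iff₀ ha1]; linarith [hab.a_pos]
  have t1 : (B + ‖y‖ ^ 2) * X1 ≤ (B + ‖y‖ ^ 2) * (6 / (1 - a) * X1) := by
    gcongr
    exact le_mul_of_one_le_left hX1p hk
  have t2 : L * (X3 / (1 - a)) ≤ L * (6 / (1 - a) * X3) := by
    gcongr
    rw [div_mul_eq_mul_div]
    gcongr
    linarith
  have t3 : (m ^ 2 + 2 * l ^ 2 * B) * (X2 / (1 - a)) + 6 * l ^ 2 * (X2 * X3 / (1 - a)) ≤
      (m ^ 2 + l ^ 2 * (B + X3)) * (6 / (1 - a) * X2) := by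
    have : 0 ≤ (5 * m ^ 2 + 4 * l ^ 2 * B) * (X2 / (1 - a)) := by positivity
    have e : (m ^ 2 + l ^ 2 * (B + X3)) * (6 / (1 - a) * X2) =
      (m ^ 2 + 2 * l ^ 2 * B) * (X2 / (1 - a)) + 6 * l ^ 2 * (X2 * X3 / (1 - a)) +
      (5 * m ^ 2 + 4 * l ^ 2 * B) * (X2 / (1 - a)) := by ring
    rw [e]
    linarith
  linarith

end OnePointRun

/-! ### Bounds uniform over the cost class -/

/-- Second moments of the iterates, uniformly over the cost class. -/
theorem exists_secondMoment_bound {a b : ℝ} (hab : AdmissibleExponents a b) (hn : 1 ≤ n)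
    {K : ℝ} (hK : 0 < K) (l L m : ℝ) (μ₁ : EuclideanSpace ℝ (Fin n)) :
    ∃ D, 0 ≤ D ∧ ∀ c : ℕ → EuclideanSpace ℝ (Fin n) → ℝ, CostClass n K l L m c →
      ∀ (Ω : Type u) (_ : MeasurableSpace Ω) (P : Measure Ω) (_ : IsProbabilityMeasure P)
        (μ x : ℕ → Ω → EuclideanSpace ℝ (Fin n)), OnePointRun a b c μ₁ P μ x →
      ∀ t, 1 ≤ t → ∫ ω, ‖μ t ω‖ ^ 2 ∂P ≤ D + 8 * L * n * biasSum a b n t := by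
  -- For other l, L the cost class is empty.
  by_cases hlL : 0 ≤ l ∧ 0 ≤ L
  swap
  · exact ⟨0, le_rfl, fun c hc => absurd
      ⟨(hc.regularCost le_rfl).l_nonneg, (hc.regularCost le_rfl).L_nonneg hn⟩ hlL⟩
  obtain ⟨hl, hL⟩ := hlL
  have hb := hab.b_pos
  have ha := hab.a_pos
  have hw : Summable fun t : ℕ => 1 / (t : ℝ) ^ (2 * a - 2 * b) :=
    Real.summable_one_div_nat_rpow.2 hab.gap
  -- With bj ≥ a the tail term α_tσ_t^j is at most t^{-(2a-2b)}.
  obtain ⟨j, hj⟩ := exists_nat_ge (a / b)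
  rw [div_le_iff₀ hb] at hj
  set R := 2 * √K with hR
  have hR0 : 0 ≤ R := by positivity
  have hR2 : R ^ 2 = 4 * K := by rw [hR, mul_pow, Real.sq_sqrt hK.le]; norm_num
  set G := ∫ z : EuclideanSpace ℝ (Fin n), ‖z‖ ^ j ∂(stdGaussian _) with hG
  have hG0 : 0 ≤ G := integral_nonneg fun z => by positivity
  set A₁ := 8 * l ^ 2 * (n : ℝ) with hA₁
  set A₂ := 2 * (l * √K * (1 / √K) ^ j * G) +
    (2 * m ^ 2 * n + 32 * l ^ 2 * n * K + 12 * l ^ 2 * n ^ 2) with hA₂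
  have hA₁0 : 0 ≤ A₁ := by positivity
  have hA₂0 : 0 ≤ A₂ := by positivity
  -- Only the bias g may fail to be summable. Its final factor 8Ln is 2Ln times 2 from Grönwall and
  -- 2 from passing from the excess back to ‖μ_t‖².
  obtain ⟨D, hD0, hD⟩ := exists_bound_of_recursion
    (ε := fun t => A₁ * (1 / (t : ℝ) ^ (2 * a - 2 * b)))
    (δ := fun t => A₂ * (1 / (t : ℝ) ^ (2 * a - 2 * b)))
    (g := fun t => 2 * L * n * (1 / ((n : ℝ) * t) ^ (a + 2 * b)))
    (fun t => by positivity) (fun t => by positivity) (fun t => by positivity)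
    (hw.mul_left A₁) (hw.mul_left A₂) (sq_nonneg ‖excess R μ₁ • μ₁‖)
  refine ⟨2 * R ^ 2 + 2 * D, by positivity, fun c hc Ω _ P _ μ x h t ht => ?_⟩
  have hm : Measurable fun v : EuclideanSpace ℝ (Fin n) => excess R v • v := by
    unfold excess; fun_prop
  have hmom : ∀ t, 1 ≤ t → ∫ ω, ‖μ t ω‖ ^ 2 ∂P ≤
      2 * R ^ 2 + 2 * ∫ ω, ‖excess R (μ t ω) • μ t ω‖ ^ 2 ∂P := by
    intro t ht
    have hX := h.memLp hc hn t ht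
    have hqX : MemLp (fun ω => excess R (μ t ω) • μ t ω) 2 P :=
      hX.mono (hm.comp_aemeasurable hX.1.aemeasurable).aestronglyMeasurable
        (ae_of_all _ fun ω => by
          rw [norm_excess_smul hR0]; exact max_le (norm_nonneg _) (by linarith))
    have i1 := (hqX.integrable_norm_pow two_ne_zero).const_mul 2
    refine (integral_mono (hX.integrable_norm_pow two_ne_zero) ((integrable_const (2 * R ^ 2)).add
      i1) fun ω => norm_sq_le_excess hR0 (μ t ω)).trans (le_of_eq ?_)
    rw [integral_add' (integrable_const _) i1]
    simp [integral_const_mul]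
  have hrec := hD (fun t => ∫ ω, ‖excess R (μ t ω) • μ t ω‖ ^ 2 ∂P)
    (fun t => integral_nonneg fun ω => by positivity) ?_ (fun s hs => ?_) t ht
  · have h1 := hmom t ht
    have h2 : ∑ s ∈ Finset.Icc 1 t, 2 * L * n * (1 / ((n : ℝ) * s) ^ (a + 2 * b)) =
        2 * L * n * biasSum a b n t := by rw [biasSum, Finset.mul_sum]
    rw [h2] at hrec
    linarith
  · refine (integral_congr_ae (g := fun _ => ‖excess R μ₁ • μ₁‖ ^ 2) ?_).le.trans (by simp)
    filter_upwards [h.init] with ω hω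
    rw [hω]
  · have hα := stepSize_pos a hn hs
    have hσ := querySd_pos b hn hs
    have key := (h.gaussianStep hs).excess_le (h.memLp hc hn s hs) (hc.regularCost hs) hn hK hσ
      hα.le j
    have h1 := hmom s hs
    rw [hR2] at h1
    have hσ1 : querySd b n s ^ 2 ≤ 1 := by
      rw [querySd_pow]
      simpa using one_div_rpow_le_one_div_rpow hn hs le_rfl (by positivity : (0 : ℝ) ≤ b * (2 : ℕ))
    have e1 : stepSize a n s * querySd b n s ^ 2 = 1 / ((n : ℝ) * s) ^ (a + 2 * b) := by
      rw [querySd_pow, stepSize, one_div_rpow_mul hn hs]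
      congr 2; push_cast; ring
    have e2 : stepSize a n s * querySd b n s ^ j ≤ 1 / (s : ℝ) ^ (2 * a - 2 * b) := by
      rw [querySd_pow, stepSize, one_div_rpow_mul hn hs]
      exact one_div_rpow_le_one_div_rpow hn hs (by linarith [hab.gap]) (by linarith)
    have e3 : (stepSize a n s / querySd b n s) ^ 2 ≤ 1 / (s : ℝ) ^ (2 * a - 2 * b) := by
      have : stepSize a n s / querySd b n s = querySd (a - b) n s := one_div_rpow_div hn hs a b
      rw [this, querySd_pow]
      exact one_div_rpow_le_one_div_rpow hn hs (by linarith [hab.gap]) (by push_cast; linarith)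
    rw [← hG, ← hR] at key
    set α := stepSize a n s
    set σ := querySd b n s
    set w := 1 / (s : ℝ) ^ (2 * a - 2 * b)
    set e := ∫ ω, ‖excess R (μ s ω) • μ s ω‖ ^ 2 ∂P
    have he : 0 ≤ e := integral_nonneg fun ω => by positivity
    have t1 : α * (l * √K * (σ / √K) ^ j * G) ≤ w * (l * √K * (1 / √K) ^ j * G) := by
      have : α * (l * √K * (σ / √K) ^ j * G) = (α * σ ^ j) * (l * √K * (1 / √K) ^ j * G) := by
        rw [div_pow, div_pow, one_pow]; ring
      rw [this]
      gcongr
    have t2 : (α / σ) ^ 2 * (2 * m ^ 2 * n + 4 * l ^ 2 * n * ∫ ω, ‖μ s ω‖ ^ 2 ∂P +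
        12 * l ^ 2 * n ^ 2 * σ ^ 2) ≤ w * (2 * m ^ 2 * n + 4 * l ^ 2 * n * (2 * (4 * K) + 2 * e) +
        12 * l ^ 2 * n ^ 2 * 1) := by
      have : 0 ≤ ∫ ω, ‖μ s ω‖ ^ 2 ∂P := integral_nonneg fun ω => by positivity
      gcongr
    refine key.trans ?_
    rw [← e1]
    rw [hA₁, hA₂]
    linarith

/-- Second moments and average regret, uniformly over the cost class. -/
theorem exists_uniform_bound {a b : ℝ} (hab : AdmissibleExponents a b) (hn : 1 ≤ n)
    {K : ℝ} (hK : 0 < K) (l L m : ℝ) (μ₁ : EuclideanSpace ℝ (Fin n)) :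
    ∃ D, 0 ≤ D ∧ ∀ c : ℕ → EuclideanSpace ℝ (Fin n) → ℝ, CostClass n K l L m c →
      ∀ (Ω : Type u) (_ : MeasurableSpace Ω) (P : Measure Ω) (_ : IsProbabilityMeasure P)
        (μ x : ℕ → Ω → EuclideanSpace ℝ (Fin n)), OnePointRun a b c μ₁ P μ x →
      (∀ t, 1 ≤ t → ∫ ω, ‖μ t ω‖ ^ 2 ∂P ≤ D + 16 * L * n * biasSum a b n t) ∧
      ∀ T : ℕ, 1 ≤ T → ∀ y : EuclideanSpace ℝ (Fin n),
      expAvgRegret c P x y T ≤ 6 / (1 - a) *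
        ((D + 16 * L * n * biasSum a b n T + ‖y‖ ^ 2) * ((n : ℝ) ^ a / (T : ℝ) ^ (1 - a)) +
          L * ((n : ℝ) ^ (1 - 2 * b) / (T : ℝ) ^ (2 * b))) := by
  obtain ⟨D, hD0, hD⟩ := exists_secondMoment_bound.{u} hab hn hK l L m μ₁
  have hn1 : (1 : ℝ) ≤ n := by exact_mod_cast hn
  have ha1 : 0 < 1 - a := by linarith [hab.a_lt_one]
  have hη : 0 < 2 * a - 2 * b - 1 := by linarith [hab.gap]
  have htend : Tendsto (fun T : ℕ => l ^ 2 * (T : ℝ) ^ (-(2 * a - 2 * b - 1))) atTop (nhds 0) := by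
    simpa using ((tendsto_rpow_neg_atTop hη).comp tendsto_natCast_atTop_atTop).const_mul (l ^ 2)
  -- From T₀ on, l²T^{-(2a-2b-1)} ≤ 1, so l² no longer multiplies the possibly growing moment bound.
  obtain ⟨T₀, hT₀⟩ := eventually_atTop.1 (htend.eventually (eventually_le_nhds one_pos))
  -- The absolute value is there because L ≥ 0 is known only once a cost sequence is given.
  set E : ℕ → ℝ := fun T => D + 8 * |L| * n * biasSum a b n T with hE
  have hEmono : Monotone E := fun S T h => by
    have := biasSum_mono a b n h
    simp only [hE]
    gcongr
  have hE0 : ∀ T, 0 ≤ E T := fun T => by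
    have := biasSum_nonneg a b n T
    simp only [hE]
    positivity
  have hET0 := hE0 T₀
  refine ⟨2 * D + (m ^ 2 + l ^ 2 * n + l ^ 2 * E T₀), by positivity,
    fun c hc Ω _ P _ μ x h => ?_⟩
  have hL := (hc.regularCost le_rfl).L_nonneg hn
  have hEL : ∀ T, E T = D + 8 * L * n * biasSum a b n T := fun T => by
    simp only [hE, abs_of_nonneg hL]
  have hS := biasSum_nonneg a b n
  refine ⟨fun t ht => (hD c hc Ω _ P ‹_› μ x h t ht).trans ?_, fun T hT y => ?_⟩
  · have : 0 ≤ m ^ 2 + l ^ 2 * n + l ^ 2 * E T₀ := by positivity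
    have : 0 ≤ L * n * biasSum a b n t := mul_nonneg (by positivity) (hS t)
    linarith
  have hT1 : (1 : ℝ) ≤ T := by exact_mod_cast hT
  have hT0 : (0 : ℝ) < T := by linarith
  have hn0 : (0 : ℝ) < n := by linarith
  refine (h.expAvgRegret_le hab hc hn hT (B := E T) (fun t ht htT => ?_) y).trans ?_
  · exact ((hD c hc Ω _ P ‹_› μ x h t ht).trans (hEL t).ge).trans (hEmono htT)
  set X1 := (n : ℝ) ^ a / (T : ℝ) ^ (1 - a) with hX1
  set X2 := (n : ℝ) ^ (1 - a + 2 * b) / (T : ℝ) ^ (a - 2 * b) with hX2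
  set X3 := (n : ℝ) ^ (1 - 2 * b) / (T : ℝ) ^ (2 * b) with hX3
  have hX1p : 0 ≤ X1 := by positivity
  have h21 : X2 ≤ X1 * (T : ℝ) ^ (-(2 * a - 2 * b - 1)) := by
    have : X1 * (T : ℝ) ^ (-(2 * a - 2 * b - 1)) = (n : ℝ) ^ a / (T : ℝ) ^ (a - 2 * b) := by
      rw [hX1, Real.rpow_neg hT0.le, ← div_eq_mul_inv, div_div, ← Real.rpow_add hT0]
      congr 2
      ring
    rw [this, hX2]
    gcongr
    linarith
  have h21' : X2 ≤ X1 := by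
    refine rpow_div_rpow_le hn hT ?_ ?_ <;> linarith
  have h3 : X3 ≤ n := by
    have := rpow_div_rpow_le hn hT (p := 1 - 2 * b) (p' := 1) (q := 2 * b) (q' := 0)
      (by linarith [hab.b_pos]) (by linarith [hab.b_pos])
    simpa using this
  -- The second copy of E T on the right turns 8 into 16; for T ≤ T₀ monotonicity of E gives the
  -- constant l²E(T₀).
  have hmain : l ^ 2 * E T * X2 ≤ (E T + l ^ 2 * E T₀) * X1 := by
    have hETn := hE0 T
    rcases le_total T₀ T with hTT | hTT
    · calc l ^ 2 * E T * X2 ≤ l ^ 2 * E T * (X1 * (T : ℝ) ^ (-(2 * a - 2 * b - 1))) := by gcongr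
        _ = E T * X1 * (l ^ 2 * (T : ℝ) ^ (-(2 * a - 2 * b - 1))) := by ring
        _ ≤ E T * X1 * 1 := by gcongr; exact hT₀ T hTT
        _ ≤ _ := by
          have : 0 ≤ l ^ 2 * E T₀ * X1 := by positivity
          linarith
    · calc l ^ 2 * E T * X2 ≤ l ^ 2 * E T₀ * X1 := by gcongr; exact hEmono hTT
        _ ≤ _ := by
          have : 0 ≤ E T * X1 := by positivity
          linarith
  have hrest : (m ^ 2 + l ^ 2 * X3) * X2 ≤ (m ^ 2 + l ^ 2 * n) * X1 := by gcongr
  have hC : 0 ≤ 6 / (1 - a) := by positivity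
  have hfin : (E T + ‖y‖ ^ 2) * X1 + (m ^ 2 + l ^ 2 * (E T + X3)) * X2 + L * X3 ≤
      (2 * D + (m ^ 2 + l ^ 2 * n + l ^ 2 * E T₀) + 16 * L * n * biasSum a b n T + ‖y‖ ^ 2) * X1 +
      L * X3 := by
    have e : (2 * D + (m ^ 2 + l ^ 2 * n + l ^ 2 * E T₀) + 16 * L * n * biasSum a b n T +
        ‖y‖ ^ 2) * X1 = (E T + ‖y‖ ^ 2) * X1 + (E T + l ^ 2 * E T₀) * X1 +
        (m ^ 2 + l ^ 2 * n) * X1 := by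
      rw [hEL T]; ring
    rw [e]
    linarith
  calc _ = 6 / (1 - a) *
        ((E T + ‖y‖ ^ 2) * X1 + (m ^ 2 + l ^ 2 * (E T + X3)) * X2 + L * X3) := by ring
    _ ≤ _ := mul_le_mul_of_nonneg_left hfin hC

/-! ### Rates -/

/-- The contribution of the accumulated bias to the regret bound. -/
theorem mul_biasSum_mul_le {a b e : ℝ} {n T : ℕ} (hn : 1 ≤ n) (hT : 1 ≤ T) (he0 : 0 ≤ e)
    (he1 : e < 1) (hab : e ≤ a + 2 * b) :
    n * biasSum a b n T * ((n : ℝ) ^ a / (T : ℝ) ^ (1 - a)) ≤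
      (n : ℝ) ^ (1 - 2 * b) / (T : ℝ) ^ (e - a) / (1 - e) := by
  have hn0 : (0 : ℝ) < n := by exact_mod_cast hn
  have hT0 : (0 : ℝ) < T := by exact_mod_cast hT
  calc n * biasSum a b n T * ((n : ℝ) ^ a / (T : ℝ) ^ (1 - a)) ≤
      n * (1 / (n : ℝ) ^ (a + 2 * b) * ((T : ℝ) ^ (1 - e) / (1 - e))) *
        ((n : ℝ) ^ a / (T : ℝ) ^ (1 - a)) := by
        gcongr; exact biasSum_le n he0 he1 hab T
    _ = (n * (n : ℝ) ^ a / (n : ℝ) ^ (a + 2 * b)) * ((T : ℝ) ^ (1 - e) / (T : ℝ) ^ (1 - a)) /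
        (1 - e) := by ring
    _ = _ := by
        have e1 : n * (n : ℝ) ^ a / (n : ℝ) ^ (a + 2 * b) = (n : ℝ) ^ (1 - 2 * b) := by
          nth_rewrite 1 [← Real.rpow_one (n : ℝ)]
          rw [← Real.rpow_add hn0, ← Real.rpow_sub hn0]
          congr 1; ring
        have e2 : (T : ℝ) ^ (1 - e) / (T : ℝ) ^ (1 - a) = 1 / (T : ℝ) ^ (e - a) := by
          rw [← Real.rpow_sub hT0, one_div, ← Real.rpow_neg hT0.le]
          congr 1; ring
        rw [e1, e2, mul_one_div]

/-- For a+2b < 1 the growing bias sum is paid by the L term, at the price 16/(1-(a+2b)) in C; for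
a+2b > 1 it converges and goes into M. At a+2b = 1 it is logarithmic. The l² term is slack. -/
theorem rate_of_ne_one {a b : ℝ} (hab : AdmissibleExponents a b) (hne : a + 2 * b ≠ 1) :
    ∃ C : ℝ, 0 < C ∧
      ∀ n : ℕ, 1 ≤ n → ∀ K l L m : ℝ, 0 < K →
      ∀ μ₁ : EuclideanSpace ℝ (Fin n), ∃ M : ℝ,
      ∀ c : ℕ → EuclideanSpace ℝ (Fin n) → ℝ, CostClass n K l L m c →
      ∀ (Ω : Type u) (_ : MeasurableSpace Ω) (P : Measure Ω)
        (_ : IsProbabilityMeasure P) (μ x : ℕ → Ω → EuclideanSpace ℝ (Fin n)),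
      OnePointRun a b c μ₁ P μ x →
      (1 < a + 2 * b → ∀ t, 1 ≤ t → ∫ ω, ‖μ t ω‖ ^ 2 ∂P ≤ M ^ 2) ∧
      ∀ T : ℕ, 1 ≤ T → ∀ y : EuclideanSpace ℝ (Fin n),
      expAvgRegret c P x y T ≤
        (M ^ 2 + ‖y‖ ^ 2) * (C * ((n : ℝ) ^ a / (T : ℝ) ^ (1 - a))) +
        l ^ 2 * (C * ((n : ℝ) ^ (1 - a + 2 * b) / (T : ℝ) ^ (a - 2 * b))) +
        L * (C * ((n : ℝ) ^ (1 - 2 * b) / (T : ℝ) ^ (2 * b))) := by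
  have ha1 : 0 < 1 - a := by linarith [hab.a_lt_one]
  have ha := hab.a_pos
  have hb := hab.b_pos
  rcases lt_or_gt_of_ne hne with hlt | hgt
  · have hd : 0 < 1 - (a + 2 * b) := by linarith
    have hfac : 1 ≤ 1 + 16 / (1 - (a + 2 * b)) := by
      have : 0 ≤ 16 / (1 - (a + 2 * b)) := by positivity
      linarith
    refine ⟨6 / (1 - a) * (1 + 16 / (1 - (a + 2 * b))), by positivity, ?_⟩
    intro n hn K l L m hK μ₁
    obtain ⟨D, hD0, hD⟩ := exists_uniform_bound.{u} hab hn hK l L m μ₁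
    refine ⟨√D, fun c hc Ω _ P _ μ x h => ⟨fun h1 => absurd h1 (by linarith), fun T hT y => ?_⟩⟩
    have hL := (hc.regularCost le_rfl).L_nonneg hn
    refine ((hD c hc Ω _ P ‹_› μ x h).2 T hT y).trans ?_
    have hbias := mul_biasSum_mul_le (a := a) (b := b) hn hT (by positivity) hlt le_rfl
    rw [add_sub_cancel_left] at hbias
    rw [Real.sq_sqrt hD0]
    have hX2 : 0 ≤ l ^ 2 * (6 / (1 - a) * (1 + 16 / (1 - (a + 2 * b))) *
      ((n : ℝ) ^ (1 - a + 2 * b) / (T : ℝ) ^ (a - 2 * b))) := by positivity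
    set X1 := (n : ℝ) ^ a / (T : ℝ) ^ (1 - a)
    set X3 := (n : ℝ) ^ (1 - 2 * b) / (T : ℝ) ^ (2 * b)
    have hX1 : 0 ≤ X1 := by positivity
    have h2 : (D + 16 * L * n * biasSum a b n T + ‖y‖ ^ 2) * X1 + L * X3 ≤
        (1 + 16 / (1 - (a + 2 * b))) * ((D + ‖y‖ ^ 2) * X1) +
          (1 + 16 / (1 - (a + 2 * b))) * (L * X3) := by
      have h3 : (D + ‖y‖ ^ 2) * X1 ≤ (1 + 16 / (1 - (a + 2 * b))) * ((D + ‖y‖ ^ 2) * X1) :=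
        le_mul_of_one_le_left (by positivity) hfac
      have h4 := mul_le_mul_of_nonneg_left hbias (by positivity : 0 ≤ 16 * L)
      have h5 : 16 * L * (X3 / (1 - (a + 2 * b))) = 16 / (1 - (a + 2 * b)) * (L * X3) := by ring
      linarith
    have h6 := mul_le_mul_of_nonneg_left h2 (by positivity : 0 ≤ 6 / (1 - a))
    linarith
  · refine ⟨6 / (1 - a), by positivity, ?_⟩
    intro n hn K l L m hK μ₁
    obtain ⟨D, hD0, hD⟩ := exists_uniform_bound.{u} hab hn hK l L m μ₁
    set Z := ∑' t : ℕ, 1 / (t : ℝ) ^ (a + 2 * b)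
    have hZ0 : 0 ≤ Z := tsum_nonneg fun t => by positivity
    refine ⟨√(D + 16 * |L| * n * Z), fun c hc Ω _ P _ μ x h => ?_⟩
    have hL := (hc.regularCost le_rfl).L_nonneg hn
    rw [Real.sq_sqrt (by positivity), abs_of_nonneg hL]
    have hZ : ∀ T, D + 16 * L * n * biasSum a b n T ≤ D + 16 * L * n * Z := fun T => by
      have := biasSum_le_tsum hn hgt T
      gcongr
    refine ⟨fun _ t ht => ((hD c hc Ω _ P ‹_› μ x h).1 t ht).trans (hZ t), fun T hT y => ?_⟩
    refine ((hD c hc Ω _ P ‹_› μ x h).2 T hT y).trans ?_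
    have hX2 : 0 ≤ l ^ 2 * (6 / (1 - a) *
      ((n : ℝ) ^ (1 - a + 2 * b) / (T : ℝ) ^ (a - 2 * b))) := by positivity
    set X1 := (n : ℝ) ^ a / (T : ℝ) ^ (1 - a)
    have h1 : (D + 16 * L * n * biasSum a b n T + ‖y‖ ^ 2) * X1 ≤
        (D + 16 * L * n * Z + ‖y‖ ^ 2) * X1 := by
      have := hZ T
      gcongr
    have h2 := mul_le_mul_of_nonneg_left h1 (by positivity : 0 ≤ 6 / (1 - a))
    linarith

theorem limsup_expAvgRegret_le {a b : ℝ} (hab : AdmissibleExponents a b) (hn : 1 ≤ n)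
    {K l L m : ℝ} (hK : 0 < K) {c : ℕ → EuclideanSpace ℝ (Fin n) → ℝ} (hc : CostClass n K l L m c)
    {μ₁ : EuclideanSpace ℝ (Fin n)} {Ω : Type u} [MeasurableSpace Ω] {P : Measure Ω}
    [IsProbabilityMeasure P] {μ x : ℕ → Ω → EuclideanSpace ℝ (Fin n)}
    (h : OnePointRun a b c μ₁ P μ x) (y : EuclideanSpace ℝ (Fin n)) :
    limsup (fun T : ℕ => ((expAvgRegret c P x y T : ℝ) : EReal)) atTop ≤ 0 := by
  have ha1 : 0 < 1 - a := by linarith [hab.a_lt_one]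
  have ha := hab.a_pos
  have hb := hab.b_pos
  have hL := (hc.regularCost le_rfl).L_nonneg hn
  obtain ⟨D, hD0, hD⟩ := exists_uniform_bound.{u} hab hn hK l L m μ₁
  -- With a < e the bias contribution decays like T^{-(e-a)}; e < min(a+2b, 1) treats all admissible
  -- pairs alike, a+2b = 1 included.
  obtain ⟨e, hae, he⟩ := exists_between (lt_min (by linarith : a < a + 2 * b) hab.a_lt_one)
  obtain ⟨he2, he1⟩ := lt_min_iff.1 he
  let U : ℕ → ℝ := fun T => 6 / (1 - a) *
    ((D + ‖y‖ ^ 2) * ((n : ℝ) ^ a / (T : ℝ) ^ (1 - a)) +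
      16 * L * ((n : ℝ) ^ (1 - 2 * b) / (T : ℝ) ^ (e - a) / (1 - e)) +
      L * ((n : ℝ) ^ (1 - 2 * b) / (T : ℝ) ^ (2 * b)))
  have hdecay : ∀ p q : ℝ, 0 < q → Tendsto (fun T : ℕ => (n : ℝ) ^ p / (T : ℝ) ^ q) atTop (nhds 0) :=
    fun p q hq => ((tendsto_rpow_atTop hq).comp tendsto_natCast_atTop_atTop).const_div_atTop _
  have hU : Tendsto U atTop (nhds 0) := by
    have := ((((hdecay a (1 - a) ha1).const_mul (D + ‖y‖ ^ 2)).add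
      (((hdecay (1 - 2 * b) (e - a) (by linarith)).div_const (1 - e)).const_mul (16 * L))).add
      ((hdecay (1 - 2 * b) (2 * b) (by linarith)).const_mul L)).const_mul (6 / (1 - a))
    simpa using this
  have hle : ∀ᶠ T : ℕ in atTop,
      ((expAvgRegret c P x y T : ℝ) : EReal) ≤ ((U T : ℝ) : EReal) := by
    filter_upwards [eventually_ge_atTop 1] with T hT
    rw [EReal.coe_le_coe_iff]
    refine ((hD c hc Ω _ P ‹_› μ x h).2 T hT y).trans ?_
    have hbias := mul_biasSum_mul_le (a := a) (b := b) hn hT (by linarith) he1 he2.le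
    have h4 := mul_le_mul_of_nonneg_left hbias (by positivity : 0 ≤ 16 * L)
    refine mul_le_mul_of_nonneg_left ?_ (by positivity)
    linarith
  have hU' : Tendsto (fun T => ((U T : ℝ) : EReal)) atTop (nhds 0) := by
    have := (continuous_coe_real_ereal.tendsto 0).comp hU
    simpa [Function.comp_def] using this
  exact (limsup_le_limsup hle).trans hU'.limsup_eq.le

theorem rate_near_optimal {ε : ℝ} (hε : 0 < ε) : ∃ δ : ℝ, 0 < δ ∧ ∃ C : ℝ, 0 < C ∧
      ∀ a b : ℝ, AdmissibleExponents a b → |a - 2 / 3| < δ → |b - 1 / 6| < δ →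
      ∀ n : ℕ, 1 ≤ n → ∀ K l L m : ℝ, 0 < K →
      ∀ μ₁ : EuclideanSpace ℝ (Fin n), ∃ M : ℝ,
      ∀ c : ℕ → EuclideanSpace ℝ (Fin n) → ℝ, CostClass n K l L m c →
      ∀ (Ω : Type u) (_ : MeasurableSpace Ω) (P : Measure Ω)
        (_ : IsProbabilityMeasure P) (μ x : ℕ → Ω → EuclideanSpace ℝ (Fin n)),
      OnePointRun a b c μ₁ P μ x →
      ∀ T : ℕ, 1 ≤ T → ∀ y : EuclideanSpace ℝ (Fin n),
      expAvgRegret c P x y T ≤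
          (M ^ 2 + ‖y‖ ^ 2 + L + l ^ 2) *
            (C * ((n : ℝ) ^ (2 / 3 + ε) / (T : ℝ) ^ (1 / 3 - ε))) ∧
      ∀ M' : ℝ, (∀ t, 1 ≤ t → t ≤ T → ∫ ω, ‖μ t ω‖ ^ 2 ∂P ≤ M' ^ 2) →
        expAvgRegret c P x y T ≤
          (M' ^ 2 + ‖y‖ ^ 2 + L +
              (m ^ 2 + l ^ 2 * (M' ^ 2 + (n : ℝ) ^ (1 - 2 * b) / (T : ℝ) ^ (2 * b)))) *
            (C * ((n : ℝ) ^ (2 / 3 + ε) / (T : ℝ) ^ (1 / 3 - ε))) := by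
  -- The bound 1/2 keeps a away from 1, so that 6/(1-a) ≤ 24, and keeps the exponent 1 - ε'/2 below
  -- positive.
  obtain ⟨ε', hε', hlt⟩ := exists_between (lt_min hε (by norm_num : (0 : ℝ) < 1 / 2))
  obtain ⟨hle, hhalf⟩ := lt_min_iff.1 hlt
  refine ⟨ε' / 12, by positivity, 24 * (1 + 32 / ε'), by positivity, ?_⟩
  intro a b hab haδ hbδ n hn K l L m hK μ₁
  rw [abs_lt] at haδ hbδ
  have ha1 : 0 < 1 - a := by linarith [hab.a_lt_one]
  have hk : 6 / (1 - a) ≤ 24 := by rw [div_le_iff₀ ha1]; linarith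
  have hk0 : 0 ≤ 6 / (1 - a) := by positivity
  have hC : (24 : ℝ) ≤ 24 * (1 + 32 / ε') := by
    have : 0 ≤ 32 / ε' := by positivity
    linarith
  obtain ⟨D, hD0, hD⟩ := exists_uniform_bound.{u} hab hn hK l L m μ₁
  refine ⟨√D, fun c hc Ω _ P _ μ x h T hT y => ?_⟩
  have hL := (hc.regularCost le_rfl).L_nonneg hn
  have hX1 := rpow_div_rpow_le hn hT (p := a) (p' := 2 / 3 + ε) (q := 1 - a) (q' := 1 / 3 - ε)
    (by linarith) (by linarith)
  have hX2 := rpow_div_rpow_le hn hT (p := 1 - a + 2 * b) (p' := 2 / 3 + ε) (q := a - 2 * b)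
    (q' := 1 / 3 - ε) (by linarith) (by linarith)
  have hX3 := rpow_div_rpow_le hn hT (p := 1 - 2 * b) (p' := 2 / 3 + ε) (q := 2 * b)
    (q' := 1 / 3 - ε) (by linarith) (by linarith)
  have hX4 := rpow_div_rpow_le hn hT (p := 1 - 2 * b) (p' := 2 / 3 + ε) (q := 1 - ε' / 2 - a)
    (q' := 1 / 3 - ε) (by linarith) (by linarith)
  set Q := (n : ℝ) ^ (2 / 3 + ε) / (T : ℝ) ^ (1 / 3 - ε)
  have hQ : 0 ≤ Q := by positivity
  constructor
  · refine ((hD c hc Ω _ P ‹_› μ x h).2 T hT y).trans ?_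
    -- Near the optimum a+2b is close to 1, on either side or equal. The fixed exponent 1 - ε'/2
    -- lies below it and gives the denominator ε'/2, independent of a and b.
    have hbias := mul_biasSum_mul_le (a := a) (b := b) (e := 1 - ε' / 2) hn hT (by linarith)
      (by linarith) (by linarith)
    rw [sub_sub_cancel] at hbias
    have hbias' := hbias.trans (div_le_div_of_nonneg_right hX4 (by positivity : 0 ≤ ε' / 2))
    have h4 := mul_le_mul_of_nonneg_left hbias' (by positivity : 0 ≤ 16 * L)
    rw [Real.sq_sqrt hD0]
    set X1 := (n : ℝ) ^ a / (T : ℝ) ^ (1 - a)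
    have h5 : (D + ‖y‖ ^ 2) * X1 ≤ (D + ‖y‖ ^ 2) * Q := by gcongr
    have h6 : L * ((n : ℝ) ^ (1 - 2 * b) / (T : ℝ) ^ (2 * b)) ≤ L * Q := by gcongr
    have h7 : 16 * L * (Q / (ε' / 2)) = 32 / ε' * (L * Q) := by field_simp; ring
    have h8 : (D + 16 * L * n * biasSum a b n T + ‖y‖ ^ 2) * X1 +
        L * ((n : ℝ) ^ (1 - 2 * b) / (T : ℝ) ^ (2 * b)) ≤
        (1 + 32 / ε') * ((D + ‖y‖ ^ 2 + L + l ^ 2) * Q) := by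
      have h9 : 0 ≤ 32 / ε' * ((D + ‖y‖ ^ 2) * Q) := by positivity
      have h10 : 0 ≤ (1 + 32 / ε') * (l ^ 2 * Q) := by positivity
      linarith
    calc _ ≤ 6 / (1 - a) * ((1 + 32 / ε') * ((D + ‖y‖ ^ 2 + L + l ^ 2) * Q)) :=
          mul_le_mul_of_nonneg_left h8 hk0
      _ ≤ 24 * ((1 + 32 / ε') * ((D + ‖y‖ ^ 2 + L + l ^ 2) * Q)) :=
          mul_le_mul_of_nonneg_right hk (by positivity)
      _ = _ := by ring
  · intro M' hM'
    refine (h.expAvgRegret_le hab hc hn hT hM' y).trans ?_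
    have hX3p : 0 ≤ (n : ℝ) ^ (1 - 2 * b) / (T : ℝ) ^ (2 * b) := by positivity
    have hmul : ∀ {X : ℝ}, 0 ≤ X → X ≤ Q → 6 / (1 - a) * X ≤ 24 * (1 + 32 / ε') * Q :=
      fun h0 hX => mul_le_mul (hk.trans hC) hX h0 (by positivity)
    have t1 := mul_le_mul_of_nonneg_left (hmul (by positivity) hX1)
      (by positivity : 0 ≤ M' ^ 2 + ‖y‖ ^ 2)
    have t2 := mul_le_mul_of_nonneg_left (hmul (by positivity) hX2)
      (by positivity : 0 ≤ m ^ 2 + l ^ 2 * (M' ^ 2 + (n : ℝ) ^ (1 - 2 * b) / (T : ℝ) ^ (2 * b)))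
    have t3 := mul_le_mul_of_nonneg_left (hmul hX3p hX3) hL
    linarith

/-- Along (2/3+s, 1/6) the gap 2a - 2b is 1 + 2s. -/
theorem optimal_mem_closure :
    ((2 / 3, 1 / 6) : ℝ × ℝ) ∈ closure {p : ℝ × ℝ | AdmissibleExponents p.1 p.2} := by
  have htend : Tendsto (fun s : ℝ => ((2 / 3 + s, 1 / 6) : ℝ × ℝ)) (nhdsWithin 0 (Set.Ioi 0))
      (nhds (2 / 3, 1 / 6)) := by
    have hc : Continuous fun s : ℝ => ((2 / 3 + s, 1 / 6) : ℝ × ℝ) := by fun_prop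
    have := (hc.tendsto 0).mono_left (nhdsWithin_le_nhds (s := Set.Ioi 0))
    simpa using this
  refine mem_closure_of_tendsto htend ?_
  filter_upwards [Ioo_mem_nhdsGT (by norm_num : (0 : ℝ) < 1 / 3)] with s hs
  exact ⟨by linarith [hs.1], by linarith [hs.2], by norm_num, by linarith [hs.1]⟩

theorem theorem1 :
    -- expectations exist, and the mean iterates are square integrable
    (∀ a b : ℝ, AdmissibleExponents a b →
      ∀ n : ℕ, 1 ≤ n → ∀ K l L m : ℝ, 0 < K →
      ∀ c : ℕ → EuclideanSpace ℝ (Fin n) → ℝ, CostClass n K l L m c →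
      ∀ (μ₁ : EuclideanSpace ℝ (Fin n)) (Ω : Type u) (_ : MeasurableSpace Ω) (P : Measure Ω)
        (_ : IsProbabilityMeasure P) (μ x : ℕ → Ω → EuclideanSpace ℝ (Fin n)),
      OnePointRun a b c μ₁ P μ x →
      (∀ t, 1 ≤ t → MemLp (μ t) 2 P) ∧ ∀ y T, Integrable (regret c x y T) P) ∧
    -- the rate in terms of any mean-square bound `M` on the iterates, `C` depends on `a, b` only
    (∀ a b : ℝ, AdmissibleExponents a b → ∃ C : ℝ, 0 < C ∧
      ∀ n : ℕ, 1 ≤ n → ∀ K l L m : ℝ, 0 < K →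
      ∀ c : ℕ → EuclideanSpace ℝ (Fin n) → ℝ, CostClass n K l L m c →
      ∀ (μ₁ : EuclideanSpace ℝ (Fin n)) (Ω : Type u) (_ : MeasurableSpace Ω) (P : Measure Ω)
        (_ : IsProbabilityMeasure P) (μ x : ℕ → Ω → EuclideanSpace ℝ (Fin n)),
      OnePointRun a b c μ₁ P μ x →
      ∀ T : ℕ, 1 ≤ T → ∀ M : ℝ,
      (∀ t, 1 ≤ t → t ≤ T → ∫ ω, ‖μ t ω‖ ^ 2 ∂P ≤ M ^ 2) →
      ∀ y : EuclideanSpace ℝ (Fin n),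
      expAvgRegret c P x y T ≤
        (M ^ 2 + ‖y‖ ^ 2) * (C * ((n : ℝ) ^ a / (T : ℝ) ^ (1 - a))) +
        (m ^ 2 + l ^ 2 * (M ^ 2 + (n : ℝ) ^ (1 - 2 * b) / (T : ℝ) ^ (2 * b))) *
          (C * ((n : ℝ) ^ (1 - a + 2 * b) / (T : ℝ) ^ (a - 2 * b))) +
        L * (C * ((n : ℝ) ^ (1 - 2 * b) / (T : ℝ) ^ (2 * b)))) ∧
    -- the rate with a constant `M` that depends only on `a, b, n, K, l, L, m` and `μ₁`, and which
    -- bounds the iterates in mean square when `a + 2 b > 1`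
    (∀ a b : ℝ, AdmissibleExponents a b → a + 2 * b ≠ 1 → ∃ C : ℝ, 0 < C ∧
      ∀ n : ℕ, 1 ≤ n → ∀ K l L m : ℝ, 0 < K →
      ∀ μ₁ : EuclideanSpace ℝ (Fin n), ∃ M : ℝ,
      ∀ c : ℕ → EuclideanSpace ℝ (Fin n) → ℝ, CostClass n K l L m c →
      ∀ (Ω : Type u) (_ : MeasurableSpace Ω) (P : Measure Ω)
        (_ : IsProbabilityMeasure P) (μ x : ℕ → Ω → EuclideanSpace ℝ (Fin n)),
      OnePointRun a b c μ₁ P μ x →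
      (1 < a + 2 * b → ∀ t, 1 ≤ t → ∫ ω, ‖μ t ω‖ ^ 2 ∂P ≤ M ^ 2) ∧
      ∀ T : ℕ, 1 ≤ T → ∀ y : EuclideanSpace ℝ (Fin n),
      expAvgRegret c P x y T ≤
        (M ^ 2 + ‖y‖ ^ 2) * (C * ((n : ℝ) ^ a / (T : ℝ) ^ (1 - a))) +
        l ^ 2 * (C * ((n : ℝ) ^ (1 - a + 2 * b) / (T : ℝ) ^ (a - 2 * b))) +
        L * (C * ((n : ℝ) ^ (1 - 2 * b) / (T : ℝ) ^ (2 * b)))) ∧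
    -- the average regret is asymptotically nonpositive
    (∀ a b : ℝ, AdmissibleExponents a b →
      ∀ n : ℕ, 1 ≤ n → ∀ K l L m : ℝ, 0 < K →
      ∀ c : ℕ → EuclideanSpace ℝ (Fin n) → ℝ, CostClass n K l L m c →
      ∀ (μ₁ : EuclideanSpace ℝ (Fin n)) (Ω : Type u) (_ : MeasurableSpace Ω) (P : Measure Ω)
        (_ : IsProbabilityMeasure P) (μ x : ℕ → Ω → EuclideanSpace ℝ (Fin n)),
      OnePointRun a b c μ₁ P μ x →
      ∀ y : EuclideanSpace ℝ (Fin n),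
      limsup (fun T : ℕ => ((expAvgRegret c P x y T : ℝ) : EReal)) atTop ≤ 0) ∧
    -- the rate for exponents close to `(2/3, 1/6)`, `C` depends on `ε` only
    (∀ ε : ℝ, 0 < ε → ∃ δ : ℝ, 0 < δ ∧ ∃ C : ℝ, 0 < C ∧
      ∀ a b : ℝ, AdmissibleExponents a b → |a - 2 / 3| < δ → |b - 1 / 6| < δ →
      ∀ n : ℕ, 1 ≤ n → ∀ K l L m : ℝ, 0 < K →
      ∀ μ₁ : EuclideanSpace ℝ (Fin n), ∃ M : ℝ,
      ∀ c : ℕ → EuclideanSpace ℝ (Fin n) → ℝ, CostClass n K l L m c →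
      ∀ (Ω : Type u) (_ : MeasurableSpace Ω) (P : Measure Ω)
        (_ : IsProbabilityMeasure P) (μ x : ℕ → Ω → EuclideanSpace ℝ (Fin n)),
      OnePointRun a b c μ₁ P μ x →
      ∀ T : ℕ, 1 ≤ T → ∀ y : EuclideanSpace ℝ (Fin n),
      expAvgRegret c P x y T ≤
          (M ^ 2 + ‖y‖ ^ 2 + L + l ^ 2) *
            (C * ((n : ℝ) ^ (2 / 3 + ε) / (T : ℝ) ^ (1 / 3 - ε))) ∧
      ∀ M' : ℝ, (∀ t, 1 ≤ t → t ≤ T → ∫ ω, ‖μ t ω‖ ^ 2 ∂P ≤ M' ^ 2) →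
        expAvgRegret c P x y T ≤
          (M' ^ 2 + ‖y‖ ^ 2 + L +
              (m ^ 2 + l ^ 2 * (M' ^ 2 + (n : ℝ) ^ (1 - 2 * b) / (T : ℝ) ^ (2 * b)))) *
            (C * ((n : ℝ) ^ (2 / 3 + ε) / (T : ℝ) ^ (1 / 3 - ε)))) ∧
    -- `(2/3, 1/6)` is the limit of admissible exponents, and no admissible exponents give a better
    -- exponent of `T` or of `n` in the sum of the three terms
    ((2 / 3, 1 / 6) ∈ closure {p : ℝ × ℝ | AdmissibleExponents p.1 p.2} ∧
      ∀ a b : ℝ, AdmissibleExponents a b →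
        min (1 - a) (min (a - 2 * b) (2 * b)) < 1 / 3 ∧
        2 / 3 < max a (max (1 - a + 2 * b) (1 - 2 * b))) := by
  refine ⟨?_, ?_, ?_, ?_, ?_, ?_, ?_⟩
  · intro a b _ n hn K l L m _ c hc μ₁ Ω _ P _ μ x h
    exact ⟨h.memLp hc hn, h.integrable_regret hc hn⟩
  · intro a b hab
    have ha1 : 0 < 1 - a := by linarith [hab.a_lt_one]
    refine ⟨6 / (1 - a), by positivity, ?_⟩
    intro n hn K l L m _ c hc μ₁ Ω _ P _ μ x h T hT M hM y
    exact h.expAvgRegret_le hab hc hn hT hM y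
  · intro a b hab hne
    exact rate_of_ne_one hab hne
  · intro a b hab n hn K l L m hK c hc μ₁ Ω _ P _ μ x h y
    exact limsup_expAvgRegret_le hab hn hK hc h y
  · intro ε hε
    exact rate_near_optimal hε
  · exact optimal_mem_closure
  · intro a b hab
    -- The gap says 2(1-a) + 2b < 1 and 2a + (1-2b) > 2, so 1-a and 2b are not both at least 1/3,
    -- nor a and 1-2b both at most 2/3.
    have := hab.gap
    constructor
    · by_contra! h
      have h1 := h.trans (min_le_left _ _)
      have h2 := (h.trans (min_le_right _ _)).trans (min_le_right _ _)
      linarith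
    · by_contra! h
      have h1 := (le_max_left _ _).trans h
      have h2 := ((le_max_right _ _).trans (le_max_right _ _)).trans h
      linarith
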